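/- Let $n>2$ be an integer, $0<\mu<n$, $0<q<1$, and let $\Omega\subset\mathbb R^n$ be a bounded domain (a nonempty, connected, bounded open set). Put $2^*=\frac{2n}{n-2}$, $2^*_\mu=\frac{2n-\mu}{n-2}$ and $$S_{H,L}=\inf_{u\in D^{1,2}(\mathbb R^n)\setminus\{0\}}\frac{\int_{\mathbb R^n}|\nabla u|^2\,dx}{\left(\int_{\mathbb R^n}\int_{\mathbb R^n}\frac{|u(x)|^{2^*_\mu}|u(y)|^{2^*_\mu}}{|x-y|^\mu}\,dx\,dy\right)^{1/2^*_\mu}},$$ where $D^{1,2}(\mathbb R^n)\subset L^{2^*}(\mathbb R^n)$ is the completion of $C_c^\infty(\mathbb R^n)$ in the norm $|\nabla u|_2$. For $\lambda>0$ and $u\in H^1_0(\Omega)$ let $$I_\lambda(u)=\frac12\int_\Omega|\nabla u|^2\,dx-\frac{\lambda}{1-q}\int_\Omega|u|^{1-q}\,dx-\frac1{2\cdot 2^*_\mu}\int_\Omega\int_\Omega\frac{|u(x)|^{2^*_\mu}|u(y)|^{2^*_\mu}}{|x-y|^\mu}\,dx\,dy .$$ Let $H_{+,q}=\{u\in H^1_0(\Omega):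 u\ge 0,\ u\not\equiv 0,\ |u|^{1-q}\in L^1(\Omega)\}$ and, for $u\in H_{+,q}$ and $t>0$, let $\phi_u(t)=I_\lambda(tu)$. Let $A$ be the set of all $\lambda>0$ such that 1. for each $u\in H_{+,q}$ the map $\phi_u$ has exactly two critical points in $(0,\infty)$, and 2. $\displaystyle\sup\left\{\int_\Omega|\nabla u|^2\,dx : u\in H_{+,q},\ \phi_u'(1)=0,\ \phi_u''(1)>0\right\}\le\left(2^*_\mu S_{H,L}^{2^*_\mu}\right)^{\frac1{2^*_\mu-1}}$, and let $\Lambda=\sup A$. Then $\Lambda$ is a well-defined real number (that is, $A$ is nonempty and bounded above), and $\Lambda>0$. -/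

import Mathlib

open MeasureTheory Filter Topology

namespace Choquard

/-- `φ ∈ C_c^∞(Ω)`: smooth, with compact support contained in `Ω`. -/
structure IsTestFunction {n : ℕ} (Ω : Set (EuclideanSpace ℝ (Fin n)))
    (φ : EuclideanSpace ℝ (Fin n) → ℝ) : Prop where
  smooth : ContDiff ℝ ((⊤ : ℕ∞) : WithTop ℕ∞) φ
  hasCompactSupport : HasCompactSupport φ
  tsupport_subset : tsupport φ ⊆ Ω

/-- `G` is the weak (distributional) gradient of `u` in `Ω`:
`∫_Ω u ∇φ = - ∫_Ω φ G` for every test function `φ`. -/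
structure HasWeakGradient {n : ℕ} (Ω : Set (EuclideanSpace ℝ (Fin n)))
    (u : EuclideanSpace ℝ (Fin n) → ℝ)
    (G : EuclideanSpace ℝ (Fin n) → EuclideanSpace ℝ (Fin n)) : Prop where
  locInt : LocallyIntegrableOn u Ω
  locInt_grad : LocallyIntegrableOn G Ω
  integral_eq : ∀ φ : EuclideanSpace ℝ (Fin n) → ℝ, IsTestFunction Ω φ →
    ∫ x in Ω, u x • gradient φ x = -∫ x in Ω, φ x • G x

open Classical in
/-- The weak gradient of `u` in `Ω` (unique almost everywhere in the open set `Ω` when it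
exists). -/
noncomputable def weakGradient {n : ℕ} (Ω : Set (EuclideanSpace ℝ (Fin n)))
    (u : EuclideanSpace ℝ (Fin n) → ℝ) : EuclideanSpace ℝ (Fin n) → EuclideanSpace ℝ (Fin n) :=
  if h : ∃ G, HasWeakGradient Ω u G then h.choose else 0

/-- `u` belongs to the closure of `C_c^∞(Ω)` for the norm `|u|_{L^p(Ω)} + |∇u|_{L^2(Ω)}`. -/
structure MemSobolevClosure {n : ℕ} (p : ENNReal) (Ω : Set (EuclideanSpace ℝ (Fin n)))
    (u : EuclideanSpace ℝ (Fin n) → ℝ) : Prop where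
  memLp : MemLp u p (volume.restrict Ω)
  hasWeakGradient : HasWeakGradient Ω u (weakGradient Ω u)
  memLp_grad : MemLp (weakGradient Ω u) 2 (volume.restrict Ω)
  approx : ∃ φ : ℕ → EuclideanSpace ℝ (Fin n) → ℝ,
    (∀ k, IsTestFunction Ω (φ k)) ∧
    Tendsto (fun k => eLpNorm (fun x => φ k x - u x) p (volume.restrict Ω)) atTop (𝓝 0) ∧
    Tendsto (fun k => eLpNorm (fun x => gradient (φ k) x - weakGradient Ω u x) 2
      (volume.restrict Ω)) atTop (𝓝 0)

/-- `u ∈ H^1_0(Ω)`. -/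
def MemH10 {n : ℕ} (Ω : Set (EuclideanSpace ℝ (Fin n)))
    (u : EuclideanSpace ℝ (Fin n) → ℝ) : Prop :=
  MemSobolevClosure 2 Ω u

/-- `u ∈ D^{1,2}(ℝⁿ)`, the completion of `C_c^∞(ℝⁿ)` for the norm `|∇u|_2`, realized inside
`L^{2*}(ℝⁿ)` with `2* = 2n/(n-2)`. -/
def MemD12 {n : ℕ} (u : EuclideanSpace ℝ (Fin n) → ℝ) : Prop :=
  MemSobolevClosure (ENNReal.ofReal (2 * n / (n - 2))) Set.univ u

/-- The upper critical exponent `2*_μ = (2n - μ)/(n - 2)`. -/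
noncomputable def critExp (n : ℕ) (μ : ℝ) : ℝ := (2 * n - μ) / (n - 2)

/-- `∫_Ω |∇u|²`. -/
noncomputable def dirichlet {n : ℕ} (Ω : Set (EuclideanSpace ℝ (Fin n)))
    (u : EuclideanSpace ℝ (Fin n) → ℝ) : ℝ :=
  ∫ x in Ω, ‖weakGradient Ω u x‖ ^ 2

/-- `∫_Ω ∫_Ω |u(x)|^{2*_μ} |u(y)|^{2*_μ} / |x - y|^μ dx dy`. -/
noncomputable def choquard {n : ℕ} (μ : ℝ) (Ω : Set (EuclideanSpace ℝ (Fin n)))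
    (u : EuclideanSpace ℝ (Fin n) → ℝ) : ℝ :=
  ∫ x in Ω, ∫ y in Ω, |u x| ^ critExp n μ * |u y| ^ critExp n μ / ‖x - y‖ ^ μ

/-- The best constant `S_{H,L}`: the infimum over `D^{1,2}(ℝⁿ) \ {0}` of the quotient of
`∫ |∇u|²` by the `1/2*_μ` power of the double integral over `ℝⁿ × ℝⁿ`. -/
noncomputable def SHL (n : ℕ) (μ : ℝ) : ℝ :=
  sInf {r : ℝ | ∃ u : EuclideanSpace ℝ (Fin n) → ℝ, MemD12 u ∧ ¬ (u =ᵐ[volume] 0) ∧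
    r = dirichlet Set.univ u / choquard μ Set.univ u ^ (1 / critExp n μ)}

/-- The energy functional `I_λ` on `H^1_0(Ω)`. -/
noncomputable def energy {n : ℕ} (μ q lam : ℝ) (Ω : Set (EuclideanSpace ℝ (Fin n)))
    (u : EuclideanSpace ℝ (Fin n) → ℝ) : ℝ :=
  1 / 2 * dirichlet Ω u - lam / (1 - q) * (∫ x in Ω, |u x| ^ (1 - q))
    - 1 / (2 * critExp n μ) * choquard μ Ω u

/-- The fiber map `φ_u(t) = I_λ(t u)`. -/
noncomputable def fiber {n : ℕ} (μ q lam : ℝ) (Ω : Set (EuclideanSpace ℝ (Fin n)))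
    (u : EuclideanSpace ℝ (Fin n) → ℝ) (t : ℝ) : ℝ :=
  energy μ q lam Ω (fun x => t * u x)

/-- `H_{+,q}`: nonnegative, not identically zero elements of `H^1_0(Ω)` with
`|u|^{1-q} ∈ L^1(Ω)`. -/
structure MemHPlus {n : ℕ} (q : ℝ) (Ω : Set (EuclideanSpace ℝ (Fin n)))
    (u : EuclideanSpace ℝ (Fin n) → ℝ) : Prop where
  memH10 : MemH10 Ω u
  nonneg : ∀ᵐ x ∂(volume.restrict Ω), 0 ≤ u x
  ne_zero : ¬ (u =ᵐ[volume.restrict Ω] 0)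
  integrable : IntegrableOn (fun x => |u x| ^ (1 - q)) Ω

/-- The set of critical points of `φ_u` in `(0, ∞)`. -/
def critPoints {n : ℕ} (μ q lam : ℝ) (Ω : Set (EuclideanSpace ℝ (Fin n)))
    (u : EuclideanSpace ℝ (Fin n) → ℝ) : Set ℝ :=
  {t : ℝ | 0 < t ∧ HasDerivAt (fiber μ q lam Ω u) 0 t}

/-- `N_λ^+ = {u ∈ H_{+,q} : φ_u'(1) = 0, φ_u''(1) > 0}`. -/
def nehariPlus {n : ℕ} (μ q lam : ℝ) (Ω : Set (EuclideanSpace ℝ (Fin n))) :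
    Set (EuclideanSpace ℝ (Fin n) → ℝ) :=
  {u | MemHPlus q Ω u ∧ HasDerivAt (fiber μ q lam Ω u) 0 1 ∧
    0 < deriv (deriv (fiber μ q lam Ω u)) 1}

/-- The set of `λ > 0` whose supremum is `Λ`. The inner supremum is taken in the extended reals,
so that the bound on it says what it should also for an unbounded set. -/
def admissible {n : ℕ} (μ q : ℝ) (Ω : Set (EuclideanSpace ℝ (Fin n))) : Set ℝ :=
  {lam : ℝ | 0 < lam ∧
    (∀ u, MemHPlus q Ω u → (critPoints μ q lam Ω u).encard = 2) ∧
    (⨆ u ∈ nehariPlus μ q lam Ω, (dirichlet Ω u : EReal)) ≤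
      (((critExp n μ * SHL n μ ^ critExp n μ) ^ (1 / (critExp n μ - 1)) : ℝ) : EReal)}

/-- The constant `Λ`. -/
noncomputable def Lam {n : ℕ} (μ q : ℝ) (Ω : Set (EuclideanSpace ℝ (Fin n))) : ℝ :=
  sSup (admissible μ q Ω)

end Choquard

/-! Write `p` for `critExp n μ`, and let `a`, `b`, `c` be the Dirichlet integral, the integral of
`|u| ^ (1 - q)` and the Choquard integral of `u`. By homogeneity the fiber map on the half line is a
combination of the powers `t ^ 2`, `t ^ (1 - q)` and `t ^ (2p)`. After multiplying its derivative by
`t ^ q`, its critical points are the positive solutions of `a t ^ (1 + q) - c t ^ (2p - 1 + q) = λ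
b`. The left side is strictly concave in the variable `t ^ (1 + q)` and vanishes at 0, so a positive
value is taken at most twice, and exactly twice when it is small enough.

Uniformity in `u` comes from two estimates. Hardy–Littlewood–Sobolev with Sobolev gives `c ≤ K a ^
p`, and Hölder on the bounded set with Sobolev gives `b ≤ B a ^ ((1 - q) / 2)`. Inserted in the
smallness condition, they leave the same power of `a` on both sides, hence one threshold for `λ`. On
`nehariPlus`, eliminating `c` gives `(2p - 2) a < (2p - 1 + q) λ b`, so `a` tends to 0 with `λ`
uniformly, and it drops below the required bound, which is positive because `SHL` is. Thus all small
`λ` are admissible.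

Conversely, a single test function bounds every admissible `λ`: a critical point on its fiber forces
`λ b` below a fixed bound for the left side. -/

namespace Choquard

/-! ### Riesz potentials and the Hardy–Littlewood–Sobolev inequality -/

section RieszKernel

variable {E : Type*} [NormedAddCommGroup E]

/-- The Riesz kernel `‖z‖ ^ (-μ)`, with values in the extended nonnegative reals. -/
noncomputable def rieszKernel (μ : ℝ) (z : E) : ENNReal := ENNReal.ofReal (‖z‖ ^ (-μ))

@[fun_prop]
lemma measurable_rieszKernel [MeasurableSpace E] [BorelSpace E] (μ : ℝ) : Measurable (rieszKernel (E := E) μ) := by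
  unfold rieszKernel
  fun_prop

lemma rieszKernel_sub_comm (μ : ℝ) (x y : E) : rieszKernel μ (x - y) = rieszKernel μ (y - x) := by
  rw [rieszKernel, rieszKernel, norm_sub_rev]

lemma rieszKernel_rpow (μ : ℝ) {s : ℝ} (hs : 0 ≤ s) (z : E) :
    rieszKernel μ z ^ s = rieszKernel (μ * s) z := by
  rw [rieszKernel, rieszKernel, ENNReal.ofReal_rpow_of_nonneg (by positivity) hs,
    ← Real.rpow_mul (norm_nonneg z)]
  congr 2
  ring

variable [NormedSpace ℝ E] [FiniteDimensional ℝ E] [Nontrivial E]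
  [MeasurableSpace E] [BorelSpace E]

/-- Polar coordinates for the lower integral of a nonnegative radial function. -/
lemma lintegral_radial_eq (m : Measure E) [m.IsAddHaarMeasure] {f : ℝ → ℝ} (hf : ∀ y, 0 ≤ f y)
    (hfi : IntegrableOn (fun y : ℝ => y ^ (Module.finrank ℝ E - 1) • f y) (Set.Ioi 0)) :
    ∫⁻ z, ENNReal.ofReal (f ‖z‖) ∂m = ENNReal.ofReal (Module.finrank ℝ E *
      (m.real (Metric.ball 0 1) * ∫ y in Set.Ioi (0 : ℝ), y ^ (Module.finrank ℝ E - 1) * f y)) := by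
  rw [← ofReal_integral_eq_lintegral_ofReal ((integrable_fun_norm_addHaar m).2 hfi)
    (ae_of_all _ fun z => hf _), integral_fun_norm_addHaar]
  simp only [nsmul_eq_mul, smul_eq_mul]

/-- In polar coordinates the density is `y ^ (d - 1 - μ)`, integrable at 0 because `μ < d`. -/
lemma exists_lintegral_rieszKernel_ball_le (m : Measure E) [m.IsAddHaarMeasure] {μ : ℝ}
    (hμ : μ < Module.finrank ℝ E) :
    ∃ C : ℝ, 0 < C ∧ ∀ R : ℝ, 0 < R →
      ∫⁻ z, (Metric.ball (0 : E) R).indicator (rieszKernel μ) z ∂m ≤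
        ENNReal.ofReal (C * R ^ (Module.finrank ℝ E - μ)) := by
  set d := Module.finrank ℝ E with hd
  have hd0 : 0 < d := Module.finrank_pos
  have hω : 0 < m.real (Metric.ball (0 : E) 1) :=
    ENNReal.toReal_pos (Metric.measure_ball_pos m 0 one_pos).ne' measure_ball_lt_top.ne
  have hdμ : (0 : ℝ) < d - μ := by linarith
  refine ⟨d * (m.real (Metric.ball (0 : E) 1) * (1 / (d - μ))), by positivity, fun R hR => ?_⟩
  have hfun : ∀ y ∈ Set.Ioi (0 : ℝ), y ^ (d - 1) • (Set.Iio R).indicator (fun y => |y| ^ (-μ)) y =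
      (Set.Iio R).indicator (fun y => y ^ ((d : ℝ) - μ - 1)) y := by
    intro y hy
    have hy : 0 < y := hy
    by_cases h : y < R
    · simp only [smul_eq_mul, Set.mem_Iio, h, Set.indicator_of_mem, abs_of_pos hy]
      rw [← Real.rpow_natCast, ← Real.rpow_add hy, Nat.cast_sub hd0]
      congr 1
      push_cast
      ring
    · simp [h]
  have hint : IntegrableOn (fun y : ℝ => y ^ ((d : ℝ) - μ - 1)) (Set.Ioc 0 R) := by
    rw [← intervalIntegrable_iff_integrableOn_Ioc_of_le hR.le]
    exact intervalIntegral.intervalIntegrable_rpow' (by linarith)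
  have hset : Set.Ioi (0 : ℝ) ∩ Set.Iio R = Set.Ioo 0 R := rfl
  have h1 := lintegral_radial_eq m (f := (Set.Iio R).indicator (fun y => |y| ^ (-μ)))
    (fun y => Set.indicator_nonneg (fun y _ => by positivity) y) (by
      rw [integrableOn_congr_fun hfun measurableSet_Ioi, integrableOn_indicator_iff measurableSet_Iio,
        Set.inter_comm, hset]
      exact hint.mono_set Set.Ioo_subset_Ioc_self)
  have h2 : ∫ y in Set.Ioi (0 : ℝ), y ^ (d - 1) *
      (Set.Iio R).indicator (fun y => |y| ^ (-μ)) y = 1 / (d - μ) * R ^ (d - μ) := by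
    have := setIntegral_congr_fun (μ := volume) measurableSet_Ioi hfun
    simp only [smul_eq_mul] at this
    rw [this, setIntegral_indicator measurableSet_Iio, hset, ← integral_Ioc_eq_integral_Ioo,
      ← intervalIntegral.integral_of_le hR.le, integral_rpow (Or.inl (by linarith)),
      sub_add_cancel, Real.zero_rpow hdμ.ne']
    ring
  rw [h2] at h1
  rw [mul_assoc, mul_assoc, ← h1]
  refine lintegral_mono fun z => ?_
  by_cases h : ‖z‖ < R
  · simp [h, rieszKernel]
  · simp [h]

/-- The same computation at infinity, where the density is integrable because `s > d`. -/
lemma exists_lintegral_rieszKernel_compl_ball_le (m : Measure E) [m.IsAddHaarMeasure] {s : ℝ}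
    (hs : Module.finrank ℝ E < s) :
    ∃ C : ℝ, 0 < C ∧ ∀ R : ℝ, 0 < R →
      ∫⁻ z, (Metric.ball (0 : E) R)ᶜ.indicator (rieszKernel s) z ∂m ≤
        ENNReal.ofReal (C * R ^ (Module.finrank ℝ E - s)) := by
  set d := Module.finrank ℝ E with hd
  have hd0 : 0 < d := Module.finrank_pos
  have hω : 0 < m.real (Metric.ball (0 : E) 1) :=
    ENNReal.toReal_pos (Metric.measure_ball_pos m 0 one_pos).ne' measure_ball_lt_top.ne
  have hdμ : (0 : ℝ) < s - d := by linarith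
  refine ⟨d * (m.real (Metric.ball (0 : E) 1) * (1 / (s - d))), by positivity, fun R hR => ?_⟩
  have hfun : ∀ y ∈ Set.Ioi (0 : ℝ), y ^ (d - 1) • (Set.Ici R).indicator (fun y => |y| ^ (-s)) y =
      (Set.Ici R).indicator (fun y => y ^ ((d : ℝ) - s - 1)) y := by
    intro y hy
    have hy : 0 < y := hy
    by_cases h : R ≤ y
    · simp only [smul_eq_mul, Set.mem_Ici, h, Set.indicator_of_mem, abs_of_pos hy]
      rw [← Real.rpow_natCast, ← Real.rpow_add hy, Nat.cast_sub hd0]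
      congr 1
      push_cast
      ring
    · simp [h]
  have hint : IntegrableOn (fun y : ℝ => y ^ ((d : ℝ) - s - 1)) (Set.Ici R) := by
    rw [integrableOn_Ici_iff_integrableOn_Ioi]
    exact integrableOn_Ioi_rpow_of_lt (by linarith) hR
  have hset : Set.Ioi (0 : ℝ) ∩ Set.Ici R = Set.Ici R :=
    Set.inter_eq_right.2 fun y hy => hR.trans_le hy
  have h1 := lintegral_radial_eq m (f := (Set.Ici R).indicator (fun y => |y| ^ (-s)))
    (fun y => Set.indicator_nonneg (fun y _ => by positivity) y) (by
      rw [integrableOn_congr_fun hfun measurableSet_Ioi, integrableOn_indicator_iff measurableSet_Ici,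
        Set.inter_comm, hset]
      exact hint)
  have h2 : ∫ y in Set.Ioi (0 : ℝ), y ^ (d - 1) *
      (Set.Ici R).indicator (fun y => |y| ^ (-s)) y = 1 / (s - d) * R ^ (d - s) := by
    have := setIntegral_congr_fun (μ := volume) measurableSet_Ioi hfun
    simp only [smul_eq_mul] at this
    rw [this, setIntegral_indicator measurableSet_Ici, hset, integral_Ici_eq_integral_Ioi,
      integral_Ioi_rpow_of_lt (by linarith) hR, sub_add_cancel]
    rw [neg_div, ← div_neg, neg_sub]
    ring
  rw [h2] at h1
  rw [mul_assoc, mul_assoc, ← h1]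
  refine lintegral_mono fun z => ?_
  by_cases h : ‖z‖ < R
  · simp [h]
  · simp [h, rieszKernel, not_lt.1 h]

/-- The pointwise bound of Hedberg type on the Riesz potential of a bounded function. -/
lemma exists_lintegral_mul_rieszKernel_le (m : Measure E) [m.IsAddHaarMeasure] {μ r : ℝ}
    (hμ0 : 0 < μ) (hμ : μ < Module.finrank ℝ E)
    (hr : r = 2 * Module.finrank ℝ E / (2 * Module.finrank ℝ E - μ)) :
    ∃ C : ℝ, 0 < C ∧ ∀ ν : Measure E, ν ≤ m → ∀ g : E → ENNReal, Measurable g →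
      ∀ b N : ℝ, 0 < b → 0 < N → (∀ y, g y ≤ ENNReal.ofReal b) →
      ∫⁻ y, g y ^ r ∂ν ≤ ENNReal.ofReal (N ^ r) → ∀ x : E,
      ∫⁻ y, g y * rieszKernel μ (x - y) ∂ν ≤ ENNReal.ofReal (C * (b ^ (r - 1) * N ^ (2 - r))) := by
  set d : ℝ := (Module.finrank ℝ E : ℝ) with hd
  have hd0 : 0 < d := by rw [hd]; exact_mod_cast Module.finrank_pos
  obtain ⟨C₁, hC₁, h₁⟩ := exists_lintegral_rieszKernel_ball_le m hμ
  obtain ⟨C₂, hC₂, h₂⟩ := exists_lintegral_rieszKernel_compl_ball_le m (s := 2 * d)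
    (by rw [← hd]; linarith)
  have hden : 0 < 2 * d - μ := by linarith
  have hrd : r * (2 * d - μ) = 2 * d := by rw [hr, div_mul_cancel₀ _ hden.ne']
  have hδ : d - μ / 2 ≠ 0 := by linarith
  have hr1 : 1 < r := by rw [hr, lt_div_iff₀ hden]; linarith
  refine ⟨C₁ + C₂ ^ (μ / (2 * d)), by positivity, ?_⟩
  intro ν hν g hg b N hb hN hgb hgN x
  -- This radius balances the near part, of order `b R ^ (d - μ)`, against the far part, of order `N
  -- R ^ (-μ / 2)`.
  set R : ℝ := (N / b) ^ (1 / (d - μ / 2)) with hR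
  have hNb : 0 < N / b := by positivity
  have hR0 : 0 < R := by positivity
  have hRpow : ∀ e : ℝ, R ^ e = N ^ (e / (d - μ / 2)) * b ^ (-(e / (d - μ / 2))) := by
    intro e
    rw [hR, ← Real.rpow_mul hNb.le, one_div_mul_eq_div, Real.div_rpow hN.le hb.le,
      Real.rpow_neg hb.le, div_eq_mul_inv]
  set B := Metric.ball (0 : E) R with hB
  have hBm : MeasurableSet B := Metric.isOpen_ball.measurableSet
  have hsplit : ∀ y, g y * rieszKernel μ (x - y) =
      g y * B.indicator (rieszKernel μ) (x - y) + g y * Bᶜ.indicator (rieszKernel μ) (x - y) := by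
    intro y
    rw [← mul_add, ← Set.indicator_self_add_compl B (rieszKernel μ)]
    by_cases h : x - y ∈ B <;> simp [h]
  have hnear : ∫⁻ y, g y * B.indicator (rieszKernel μ) (x - y) ∂ν ≤
      ENNReal.ofReal (C₁ * (b ^ (r - 1) * N ^ (2 - r))) := by
    calc ∫⁻ y, g y * B.indicator (rieszKernel μ) (x - y) ∂ν
        ≤ ∫⁻ y, ENNReal.ofReal b * B.indicator (rieszKernel μ) (x - y) ∂m :=
          lintegral_mono' hν fun y => mul_le_mul_left (hgb y) _
      _ = ENNReal.ofReal b * ∫⁻ y, B.indicator (rieszKernel μ) (x - y) ∂m :=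
          lintegral_const_mul' _ _ ENNReal.ofReal_ne_top
      _ = ENNReal.ofReal b * ∫⁻ z, B.indicator (rieszKernel μ) z ∂m := by
          rw [lintegral_sub_left_eq_self (μ := m) (B.indicator (rieszKernel μ)) x]
      _ ≤ ENNReal.ofReal b * ENNReal.ofReal (C₁ * R ^ (d - μ)) := mul_le_mul_right (h₁ R hR0) _
      _ = _ := by
          rw [← ENNReal.ofReal_mul hb.le, hRpow]
          have e1 : (d - μ) / (d - μ / 2) = 2 - r := by
            rw [div_eq_iff hδ]
            linear_combination hrd / 2
          have e2 : b ^ (r - 1) = b * b ^ (-(2 - r)) := by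
            rw [show r - 1 = 1 + -(2 - r) by ring, Real.rpow_add hb, Real.rpow_one]
          rw [e1, e2]
          congr 1
          ring
  have hfar : ∫⁻ y, g y * Bᶜ.indicator (rieszKernel μ) (x - y) ∂ν ≤
      ENNReal.ofReal (C₂ ^ (μ / (2 * d)) * (b ^ (r - 1) * N ^ (2 - r))) := by
    -- Hölder with the conjugate exponent `2d / μ` turns the kernel into `rieszKernel (2 * d)`,
    -- which is integrable away from the origin.
    have hconj : r.HolderConjugate (2 * d / μ) := by
      rw [Real.holderConjugate_iff]
      refine ⟨hr1, ?_⟩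
      rw [hr]
      field_simp
      ring
    have hk : ∀ z, Bᶜ.indicator (rieszKernel μ) z ^ (2 * d / μ) =
        Bᶜ.indicator (rieszKernel (2 * d)) z := by
      intro z
      by_cases h : z ∈ B
      · simp only [Set.mem_compl_iff, h, not_true_eq_false, not_false_eq_true,
          Set.indicator_of_notMem]
        exact ENNReal.zero_rpow_of_pos (by positivity)
      · simp only [Set.mem_compl_iff, h, not_false_eq_true, Set.indicator_of_mem]
        rw [rieszKernel_rpow _ (by positivity)]
        congr 1
        field_simp
    have hmk : Measurable (fun y => Bᶜ.indicator (rieszKernel μ) (x - y)) :=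
      ((measurable_rieszKernel μ).indicator hBm.compl).comp (by fun_prop)
    calc ∫⁻ y, g y * Bᶜ.indicator (rieszKernel μ) (x - y) ∂ν
        ≤ (∫⁻ y, g y ^ r ∂ν) ^ (1 / r) *
          (∫⁻ y, Bᶜ.indicator (rieszKernel μ) (x - y) ^ (2 * d / μ) ∂ν) ^ (1 / (2 * d / μ)) :=
          ENNReal.lintegral_mul_le_Lp_mul_Lq ν hconj hg.aemeasurable hmk.aemeasurable
      _ ≤ (ENNReal.ofReal (N ^ r)) ^ (1 / r) *
          (∫⁻ y, Bᶜ.indicator (rieszKernel (2 * d)) (x - y) ∂m) ^ (1 / (2 * d / μ)) := by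
          gcongr
          exact (hk _).le
      _ ≤ ENNReal.ofReal N * (ENNReal.ofReal (C₂ * R ^ (d - 2 * d))) ^ (1 / (2 * d / μ)) := by
          gcongr
          · rw [ENNReal.ofReal_rpow_of_pos (by positivity), ← Real.rpow_mul hN.le,
              mul_one_div_cancel (by positivity), Real.rpow_one]
          · rw [lintegral_sub_left_eq_self (μ := m) (Bᶜ.indicator (rieszKernel (2 * d))) x]
            exact h₂ R hR0
      _ = _ := by
          rw [ENNReal.ofReal_rpow_of_pos (by positivity), ← ENNReal.ofReal_mul hN.le,
            Real.mul_rpow hC₂.le (by positivity), ← Real.rpow_mul hR0.le, hRpow, one_div_div]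
          have e1 : (d - 2 * d) * (μ / (2 * d)) / (d - μ / 2) = -(r - 1) := by
            have h3 : d * (μ / (2 * d)) = μ / 2 := by field_simp
            rw [div_eq_iff hδ]
            linear_combination -h3 + hrd / 2
          have e2 : N ^ (2 - r) = N * N ^ (-(r - 1)) := by
            rw [show 2 - r = 1 + -(r - 1) by ring, Real.rpow_add hN, Real.rpow_one]
          rw [e1, e2, neg_neg]
          congr 1
          ring
  calc ∫⁻ y, g y * rieszKernel μ (x - y) ∂ν
      = ∫⁻ y, (g y * B.indicator (rieszKernel μ) (x - y) +
          g y * Bᶜ.indicator (rieszKernel μ) (x - y)) ∂ν := lintegral_congr hsplit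
    _ = ∫⁻ y, g y * B.indicator (rieszKernel μ) (x - y) ∂ν +
          ∫⁻ y, g y * Bᶜ.indicator (rieszKernel μ) (x - y) ∂ν :=
        lintegral_add_left (hg.mul (((measurable_rieszKernel μ).indicator hBm).comp
          (by fun_prop))) _
    _ ≤ _ := by
        rw [add_mul, ENNReal.ofReal_add (by positivity) (by positivity)]
        exact add_le_add hnear hfar

/-- The diagonal case of the **Hardy–Littlewood–Sobolev inequality**. -/
theorem exists_hardyLittlewoodSobolev (m : Measure E) [m.IsAddHaarMeasure] {μ r : ℝ}
    (hμ0 : 0 < μ) (hμ : μ < Module.finrank ℝ E)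
    (hr : r = 2 * Module.finrank ℝ E / (2 * Module.finrank ℝ E - μ)) :
    ∃ C : ℝ, 0 < C ∧ ∀ ν : Measure E, [SFinite ν] → ν ≤ m → ∀ f : E → ENNReal, AEMeasurable f ν →
      ∫⁻ x, ∫⁻ y, f x * f y * rieszKernel μ (x - y) ∂ν ∂ν ≤
        ENNReal.ofReal C * (∫⁻ x, f x ^ r ∂ν) ^ (2 / r) := by
  obtain ⟨C, hC, h⟩ := exists_lintegral_mul_rieszKernel_le m hμ0 hμ hr
  have hd0 : (0 : ℝ) < Module.finrank ℝ E := by exact_mod_cast Module.finrank_pos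
  have hden : 0 < 2 * (Module.finrank ℝ E : ℝ) - μ := by linarith
  have hr1 : 1 < r := by rw [hr, lt_div_iff₀ hden]; linarith
  refine ⟨2 * C, by positivity, fun ν _ hν f₀ hf₀ => ?_⟩
  wlog hf : Measurable f₀ generalizing f₀ with H
  · have hae := hf₀.ae_eq_mk
    refine le_trans (le_of_eq ?_) ((H (hf₀.mk f₀) hf₀.measurable_mk.aemeasurable
      hf₀.measurable_mk).trans (le_of_eq ?_))
    · refine lintegral_congr_ae ?_
      filter_upwards [hae] with x hx
      refine lintegral_congr_ae ?_
      filter_upwards [hae] with y hy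
      rw [hx, hy]
    · congr 2
      refine lintegral_congr_ae ?_
      filter_upwards [hae] with x hx
      rw [hx]
  rename' f₀ => f
  rcases eq_or_ne (∫⁻ x, f x ^ r ∂ν) 0 with h0 | h0
  · rw [lintegral_eq_zero_iff (by fun_prop)] at h0
    have h1 : ∀ᵐ x ∂ν, f x = 0 := by
      filter_upwards [h0] with x hx
      simpa [ENNReal.rpow_eq_zero_iff, (by linarith : 0 < r), not_lt.2 (by linarith : 0 ≤ r)]
        using hx
    refine le_trans (le_of_eq ?_) (zero_le)
    rw [lintegral_eq_zero_iff' (by fun_prop)]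
    filter_upwards [h1] with x hx
    simp [hx]
  rcases eq_or_ne (∫⁻ x, f x ^ r ∂ν) ⊤ with hT | hT
  · rw [hT, ENNReal.top_rpow_of_pos (by positivity), ENNReal.mul_top (by simpa using hC)]
    exact le_top
  set N : ℝ := (∫⁻ x, f x ^ r ∂ν).toReal ^ (1 / r) with hN
  have hN0 : 0 < N := Real.rpow_pos_of_pos (ENNReal.toReal_pos h0 hT) _
  have hNr : ENNReal.ofReal (N ^ r) = ∫⁻ x, f x ^ r ∂ν := by
    rw [hN, ← Real.rpow_mul ENNReal.toReal_nonneg, one_div_mul_cancel (by positivity),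
      Real.rpow_one, ENNReal.ofReal_toReal hT]
  -- The half of the integrand with `f y ≤ f x`; by symmetry of the kernel it suffices to bound its
  -- integral. There `f` is truncated at height `f x`, so the pointwise bound with `b = f x` makes
  -- the inner integral at most a constant times `N ^ (2 - r) * f x ^ r`.
  set F : E → E → ENNReal := fun x y =>
    f x * ({z | f z ≤ f x}.indicator f y * rieszKernel μ (x - y)) with hF
  have hFm : Measurable (Function.uncurry F) := by
    have : Function.uncurry F = fun p : E × E => f p.1 *
        ({p : E × E | f p.2 ≤ f p.1}.indicator (fun p => f p.2) p * rieszKernel μ (p.1 - p.2)) := by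
      ext ⟨x, y⟩
      simp [hF, Function.uncurry, Set.indicator]
    rw [this]
    refine (hf.comp measurable_fst).mul (Measurable.mul ?_ (by fun_prop))
    exact (hf.comp measurable_snd).indicator
      (measurableSet_le (hf.comp measurable_snd) (hf.comp measurable_fst))
  have hle : ∀ x y, f x * f y * rieszKernel μ (x - y) ≤ F x y + F y x := by
    intro x y
    rcases le_total (f y) (f x) with hxy | hxy
    · refine le_trans (le_of_eq ?_) le_self_add
      simp [hF, hxy, mul_assoc]
    · refine le_trans (le_of_eq ?_) le_add_self
      simp only [hF, Set.indicator, Set.mem_ofPred_eq, hxy, if_true]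
      rw [rieszKernel_sub_comm μ y x]
      ring
  have hone : ∫⁻ x, ∫⁻ y, F x y ∂ν ∂ν ≤ ENNReal.ofReal (C * N ^ (2 : ℝ)) := by
    have hfin : ∀ᵐ x ∂ν, f x ^ r < ⊤ := ae_lt_top (by fun_prop) hT
    have hb : ∀ᵐ x ∂ν, ∫⁻ y, F x y ∂ν ≤ ENNReal.ofReal (C * N ^ (2 - r)) * f x ^ r := by
      filter_upwards [hfin] with x hx
      rcases eq_or_ne (f x) 0 with hx0 | hx0
      · simp [hF, hx0]
      have hxT : f x ≠ ⊤ := by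
        intro hxT
        simp [hxT, ENNReal.top_rpow_of_pos (by linarith : 0 < r)] at hx
      have hx1 : 0 < (f x).toReal := ENNReal.toReal_pos hx0 hxT
      have hms : MeasurableSet {z | f z ≤ f x} := measurableSet_le hf measurable_const
      have key := h ν hν ({z | f z ≤ f x}.indicator f) (hf.indicator hms) (f x).toReal N hx1 hN0
        (fun y => by
          rw [ENNReal.ofReal_toReal hxT]
          by_cases hy : f y ≤ f x <;> simp [hy])
        (by
          rw [hNr]
          refine lintegral_mono fun y => ?_
          exact ENNReal.rpow_le_rpow (Set.indicator_le_self _ _ _) (by linarith)) x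
      calc ∫⁻ y, F x y ∂ν
          = f x * ∫⁻ y, {z | f z ≤ f x}.indicator f y * rieszKernel μ (x - y) ∂ν :=
            lintegral_const_mul' _ _ hxT
        _ ≤ f x * ENNReal.ofReal (C * ((f x).toReal ^ (r - 1) * N ^ (2 - r))) :=
            mul_le_mul_right key _
        _ = ENNReal.ofReal (C * N ^ (2 - r)) * f x ^ r := by
            nth_rewrite 1 3 [← ENNReal.ofReal_toReal hxT]
            rw [ENNReal.ofReal_rpow_of_pos hx1, ← ENNReal.ofReal_mul hx1.le,
              ← ENNReal.ofReal_mul (by positivity)]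
            congr 1
            have : (f x).toReal ^ r = (f x).toReal * (f x).toReal ^ (r - 1) := by
              nth_rewrite 2 [← Real.rpow_one (f x).toReal]
              rw [← Real.rpow_add hx1]
              congr 1
              ring
            rw [this]
            ring
    calc ∫⁻ x, ∫⁻ y, F x y ∂ν ∂ν ≤ ∫⁻ x, ENNReal.ofReal (C * N ^ (2 - r)) * f x ^ r ∂ν :=
          lintegral_mono_ae hb
      _ = ENNReal.ofReal (C * N ^ (2 - r)) * ENNReal.ofReal (N ^ r) := by
          rw [lintegral_const_mul' _ _ ENNReal.ofReal_ne_top, hNr]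
      _ = _ := by
          rw [← ENNReal.ofReal_mul (by positivity), mul_assoc, ← Real.rpow_add hN0]
          congr 3
          ring
  have hNfin : ENNReal.ofReal (N ^ (2 : ℝ)) = (∫⁻ x, f x ^ r ∂ν) ^ (2 / r) := by
    rw [← hNr, ENNReal.ofReal_rpow_of_pos (by positivity), ← Real.rpow_mul hN0.le]
    congr 2
    field_simp
  calc ∫⁻ x, ∫⁻ y, f x * f y * rieszKernel μ (x - y) ∂ν ∂ν
      ≤ ∫⁻ x, ∫⁻ y, (F x y + F y x) ∂ν ∂ν := lintegral_mono fun x => lintegral_mono fun y => hle x y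
    _ = ∫⁻ x, ∫⁻ y, F x y ∂ν ∂ν + ∫⁻ x, ∫⁻ y, F y x ∂ν ∂ν := by
        rw [← lintegral_add_left (f := fun x => ∫⁻ y, F x y ∂ν) hFm.lintegral_prod_right']
        refine lintegral_congr fun x => ?_
        exact lintegral_add_left (hFm.comp measurable_prodMk_left) _
    _ = ∫⁻ x, ∫⁻ y, F x y ∂ν ∂ν + ∫⁻ x, ∫⁻ y, F x y ∂ν ∂ν := by
        congr 1
        exact lintegral_lintegral_swap (hFm.comp measurable_swap).aemeasurable
    _ ≤ ENNReal.ofReal (C * N ^ (2 : ℝ)) + ENNReal.ofReal (C * N ^ (2 : ℝ)) :=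
        add_le_add hone hone
    _ = _ := by
        rw [← hNfin, ← ENNReal.ofReal_mul (by positivity), ← ENNReal.ofReal_add (by positivity)
          (by positivity)]
        congr 1
        ring

end RieszKernel

/-! ### Weak gradients and homogeneity of the energy -/

section WeakGradient

variable {n : ℕ} {Ω : Set (EuclideanSpace ℝ (Fin n))} {u φ : EuclideanSpace ℝ (Fin n) → ℝ}
  {G G' : EuclideanSpace ℝ (Fin n) → EuclideanSpace ℝ (Fin n)}

lemma norm_gradient (x : EuclideanSpace ℝ (Fin n)) : ‖gradient φ x‖ = ‖fderiv ℝ φ x‖ :=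
  (InnerProductSpace.toDual ℝ (EuclideanSpace ℝ (Fin n))).symm.norm_map _

lemma support_gradient_subset : Function.support (gradient φ) ⊆ tsupport φ := by
  intro x hx
  refine support_fderiv_subset ℝ fun h => hx ?_
  rw [← norm_eq_zero, norm_gradient, h, norm_zero]

namespace IsTestFunction

lemma contDiff_one (hφ : IsTestFunction Ω φ) : ContDiff ℝ 1 φ := hφ.smooth.of_le (by simp)

lemma continuous (hφ : IsTestFunction Ω φ) : Continuous φ := hφ.smooth.continuous

lemma continuous_gradient (hφ : IsTestFunction Ω φ) : Continuous (gradient φ) :=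
  (InnerProductSpace.toDual ℝ (EuclideanSpace ℝ (Fin n))).symm.continuous.comp
    (hφ.contDiff_one.continuous_fderiv one_ne_zero)

lemma hasCompactSupport_gradient (hφ : IsTestFunction Ω φ) : HasCompactSupport (gradient φ) :=
  hφ.hasCompactSupport.mono' support_gradient_subset

lemma integrable_smul (hφ : IsTestFunction Ω φ) (hG : LocallyIntegrableOn G Ω) :
    Integrable (fun x => φ x • G x) := by
  have h := (hG.integrableOn_compact_subset hφ.tsupport_subset
    hφ.hasCompactSupport).continuousOn_smul hφ.continuous.continuousOn hφ.hasCompactSupport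
  refine (integrableOn_iff_integrable_of_support_subset fun x hx => ?_).1 h
  exact subset_tsupport φ fun h0 => hx (by simp [h0])

lemma setIntegral_smul_eq (hφ : IsTestFunction Ω φ) :
    ∫ x in Ω, φ x • G x = ∫ x, φ x • G x :=
  setIntegral_eq_integral_of_forall_compl_eq_zero fun x hx => by
    rw [image_eq_zero_of_notMem_tsupport fun h => hx (hφ.tsupport_subset h), zero_smul]

end IsTestFunction

/-- Weak gradients are unique almost everywhere. -/
lemma HasWeakGradient.ae_eq (hΩ : IsOpen Ω) (h : HasWeakGradient Ω u G)
    (h' : HasWeakGradient Ω u G') : G =ᵐ[volume.restrict Ω] G' := by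
  have key := hΩ.ae_eq_zero_of_integral_contDiff_smul_eq_zero (μ := volume)
    (h.locInt_grad.sub h'.locInt_grad) fun g hg hgc hgs => by
      have hgT : IsTestFunction Ω g := ⟨hg, hgc, hgs⟩
      simp only [Pi.sub_apply, smul_sub]
      rw [integral_sub (hgT.integrable_smul h.locInt_grad) (hgT.integrable_smul h'.locInt_grad),
        ← hgT.setIntegral_smul_eq, ← hgT.setIntegral_smul_eq, sub_eq_zero, ← neg_inj,
        ← h.integral_eq g hgT, ← h'.integral_eq g hgT]
  rw [EventuallyEq, ae_restrict_iff' hΩ.measurableSet]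
  filter_upwards [key] with x hx hxΩ
  exact sub_eq_zero.1 (hx hxΩ)

lemma HasWeakGradient.const_mul (h : HasWeakGradient Ω u G) (t : ℝ) :
    HasWeakGradient Ω (fun x => t * u x) (fun x => t • G x) where
  locInt := h.locInt.smul t
  locInt_grad := h.locInt_grad.smul t
  integral_eq φ hφ := by
    simp only [mul_smul, smul_comm _ t]
    rw [integral_smul, integral_smul, h.integral_eq φ hφ, smul_neg]

/-- The defining property of `weakGradient`. -/
lemma HasWeakGradient.hasWeakGradient_weakGradient (h : HasWeakGradient Ω u G) :
    HasWeakGradient Ω u (weakGradient Ω u) := by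
  have hex : ∃ G, HasWeakGradient Ω u G := ⟨G, h⟩
  rw [weakGradient, dif_pos hex]
  exact hex.choose_spec

lemma HasWeakGradient.weakGradient_ae_eq (hΩ : IsOpen Ω) (h : HasWeakGradient Ω u G) :
    weakGradient Ω u =ᵐ[volume.restrict Ω] G :=
  h.hasWeakGradient_weakGradient.ae_eq hΩ h

/-- Integration by parts: the gradient of a test function is its weak gradient. -/
lemma IsTestFunction.hasWeakGradient (hφ : IsTestFunction Ω φ) :
    HasWeakGradient Ω φ (gradient φ) where
  locInt := hφ.continuous.locallyIntegrable.locallyIntegrableOn _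
  locInt_grad := hφ.continuous_gradient.locallyIntegrable.locallyIntegrableOn _
  integral_eq ψ hψ := by
    have hint : ∀ {f g : EuclideanSpace ℝ (Fin n) → ℝ}, IsTestFunction Ω f → IsTestFunction Ω g →
        Integrable (fun x => f x • gradient g x) := fun hf hg =>
      hf.integrable_smul (hg.continuous_gradient.locallyIntegrable.locallyIntegrableOn _)
    have hinner : ∀ {f g : EuclideanSpace ℝ (Fin n) → ℝ} (v x : EuclideanSpace ℝ (Fin n)),
        inner ℝ v (f x • gradient g x) = f x * fderiv ℝ g x v := fun v x => by
      rw [real_inner_smul_right, real_inner_comm, inner_gradient_left]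
    rw [hφ.setIntegral_smul_eq, hψ.setIntegral_smul_eq]
    -- Pairing with a fixed vector reduces the identity to scalar integration by parts in the
    -- direction `v`.
    refine ext_inner_left ℝ fun v => ?_
    rw [inner_neg_right, ← integral_inner (hint hφ hψ), ← integral_inner (hint hψ hφ)]
    have h1 := (hint hφ hψ).const_inner (𝕜 := ℝ) v
    have h2 := (hint hψ hφ).const_inner (𝕜 := ℝ) v
    simp only [hinner] at h1 h2 ⊢
    rw [integral_mul_fderiv_eq_neg_fderiv_mul_of_integrable]
    · simp only [mul_comm]
    · simpa only [mul_comm] using h2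
    · exact h1
    · exact (hφ.continuous.mul hψ.continuous).integrable_of_hasCompactSupport
        hφ.hasCompactSupport.mul_right
    · exact fun x _ => hφ.contDiff_one.differentiable one_ne_zero x
    · exact fun x _ => hψ.contDiff_one.differentiable one_ne_zero x

lemma IsTestFunction.memSobolevClosure (hΩ : IsOpen Ω) (hφ : IsTestFunction Ω φ) (p : ENNReal) :
    MemSobolevClosure p Ω φ where
  memLp := hφ.continuous.memLp_of_hasCompactSupport hφ.hasCompactSupport
  hasWeakGradient := hφ.hasWeakGradient.hasWeakGradient_weakGradient
  memLp_grad := (hφ.continuous_gradient.memLp_of_hasCompactSupport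
    hφ.hasCompactSupport_gradient).ae_eq (hφ.hasWeakGradient.weakGradient_ae_eq hΩ).symm
  approx := by
    refine ⟨fun _ => φ, fun _ => hφ, by simp, ?_⟩
    have h : (fun x => gradient φ x - weakGradient Ω φ x) =ᵐ[volume.restrict Ω] 0 := by
      filter_upwards [hφ.hasWeakGradient.weakGradient_ae_eq hΩ] with x hx
      simp [hx]
    simp [eLpNorm_congr_ae h]

lemma dirichlet_nonneg : 0 ≤ dirichlet Ω u := integral_nonneg fun _ => by positivity

lemma MemSobolevClosure.eLpNorm_weakGradient {p : ENNReal} (h : MemSobolevClosure p Ω u) :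
    eLpNorm (weakGradient Ω u) 2 (volume.restrict Ω) =
      ENNReal.ofReal (dirichlet Ω u ^ (1 / 2 : ℝ)) := by
  rw [h.memLp_grad.eLpNorm_eq_integral_rpow_norm two_ne_zero ENNReal.ofNat_ne_top]
  simp [dirichlet]

/-- Since `weakGradient` is a choice, it commutes with scaling only almost everywhere, by
uniqueness. -/
lemma MemSobolevClosure.dirichlet_const_mul {p : ENNReal} (hΩ : IsOpen Ω)
    (h : MemSobolevClosure p Ω u) (t : ℝ) :
    dirichlet Ω (fun x => t * u x) = t ^ 2 * dirichlet Ω u := by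
  rw [dirichlet, dirichlet, ← integral_const_mul]
  refine integral_congr_ae ?_
  filter_upwards [(h.hasWeakGradient.const_mul t).weakGradient_ae_eq hΩ] with x hx
  rw [hx, norm_smul, mul_pow, Real.norm_eq_abs, sq_abs]

lemma choquard_const_mul (μ : ℝ) {t : ℝ} (ht : 0 ≤ t) :
    choquard μ Ω (fun x => t * u x) = t ^ (2 * critExp n μ) * choquard μ Ω u := by
  rw [choquard, choquard, ← integral_const_mul]
  refine integral_congr_ae (ae_of_all _ fun x => ?_)
  dsimp only
  rw [← integral_const_mul]
  refine integral_congr_ae (ae_of_all _ fun y => ?_)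
  dsimp only
  rw [abs_mul, abs_mul, Real.mul_rpow (abs_nonneg _) (abs_nonneg _),
    Real.mul_rpow (abs_nonneg _) (abs_nonneg _), abs_of_nonneg ht, mul_comm 2,
    Real.rpow_mul ht, Real.rpow_two]
  ring

lemma setIntegral_rpow_const_mul {s : ℝ} {t : ℝ} (ht : 0 ≤ t) :
    ∫ x in Ω, |t * u x| ^ s = t ^ s * ∫ x in Ω, |u x| ^ s := by
  rw [← integral_const_mul]
  refine integral_congr_ae (ae_of_all _ fun x => ?_)
  dsimp only
  rw [abs_mul, Real.mul_rpow (abs_nonneg _) (abs_nonneg _), abs_of_nonneg ht]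

/-- The fiber map on the half line is an explicit combination of powers. -/
lemma MemSobolevClosure.fiber_eq {p : ENNReal} (hΩ : IsOpen Ω) (h : MemSobolevClosure p Ω u)
    (μ q lam : ℝ) {t : ℝ} (ht : 0 ≤ t) :
    fiber μ q lam Ω u t = 1 / 2 * (t ^ 2 * dirichlet Ω u)
      - lam / (1 - q) * (t ^ (1 - q) * ∫ x in Ω, |u x| ^ (1 - q))
      - 1 / (2 * critExp n μ) * (t ^ (2 * critExp n μ) * choquard μ Ω u) := by
  rw [fiber, energy, h.dirichlet_const_mul hΩ, choquard_const_mul μ ht,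
    setIntegral_rpow_const_mul ht]

end WeakGradient

/-! ### The Sobolev inequality -/

section Sobolev

variable {n : ℕ}

/-- The Sobolev inequality at the critical exponent for test functions. -/
lemma IsTestFunction.exists_eLpNorm_le (hn : 2 < n) :
    ∃ C : NNReal, ∀ (Ω : Set (EuclideanSpace ℝ (Fin n))) (φ : EuclideanSpace ℝ (Fin n) → ℝ),
      IsTestFunction Ω φ →
      eLpNorm φ (ENNReal.ofReal (2 * n / (n - 2))) (volume.restrict Ω) ≤
        C * eLpNorm (gradient φ) 2 (volume.restrict Ω) := by
  refine ⟨SNormLESNormFDerivOfEqConst ℝ (volume : Measure (EuclideanSpace ℝ (Fin n))) 2,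
    fun Ω φ hφ => ?_⟩
  have hn' : (2 : ℝ) < n := by exact_mod_cast hn
  have h2 : (0 : ℝ) < n - 2 := by linarith
  have hsob := eLpNorm_le_eLpNorm_fderiv_of_eq (volume : Measure (EuclideanSpace ℝ (Fin n)))
    hφ.contDiff_one hφ.hasCompactSupport (p := 2) (p' := (2 * n / (n - 2) : ℝ).toNNReal)
    one_le_two (by rw [finrank_euclideanSpace_fin]; omega) (by
      rw [finrank_euclideanSpace_fin, Real.coe_toNNReal _ (by positivity)]
      push_cast
      field_simp)
  have hsupp : Function.support φ ⊆ Ω := (subset_tsupport φ).trans hφ.tsupport_subset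
  -- Both supports lie in `Ω`, so the whole-space inequality applies and its constant does not
  -- depend on `Ω`.
  rw [eLpNorm_restrict_eq_of_support_subset hsupp, eLpNorm_restrict_eq_of_support_subset
    (support_gradient_subset.trans hφ.tsupport_subset)]
  refine hsob.trans (le_of_eq ?_)
  congr 1
  exact eLpNorm_congr_norm_ae (ae_of_all _ fun x => (norm_gradient x).symm)

/-- The Sobolev inequality in the closure of the test functions. -/
theorem MemSobolevClosure.exists_eLpNorm_le (hn : 2 < n) :
    ∃ C : NNReal, ∀ (p : ENNReal) (Ω : Set (EuclideanSpace ℝ (Fin n)))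
      (u : EuclideanSpace ℝ (Fin n) → ℝ), p ≠ 0 → MemSobolevClosure p Ω u →
      eLpNorm u (ENNReal.ofReal (2 * n / (n - 2))) (volume.restrict Ω) ≤
        C * eLpNorm (weakGradient Ω u) 2 (volume.restrict Ω) := by
  obtain ⟨C, hC⟩ := IsTestFunction.exists_eLpNorm_le hn
  refine ⟨C, fun p Ω u hp h => ?_⟩
  obtain ⟨φ, hφ, hφu, hφG⟩ := h.approx
  have hmeas : ∀ k, AEStronglyMeasurable (φ k) (volume.restrict Ω) := fun k =>
    (hφ k).continuous.aestronglyMeasurable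
  -- The exponent `p` serves only to extract an almost everywhere convergent subsequence. Fatou then
  -- bounds the critical norm, so one constant serves both `MemH10` and `MemD12`.
  obtain ⟨ns, hns, hlim⟩ := (tendstoInMeasure_of_tendsto_eLpNorm hp hmeas
    h.memLp.aestronglyMeasurable hφu).exists_seq_tendsto_ae
  refine (Lp.eLpNorm_lim_le_liminf_eLpNorm (fun k => hmeas (ns k)) u hlim).trans ?_
  have hbound : ∀ k, eLpNorm (φ (ns k)) (ENNReal.ofReal (2 * n / (n - 2))) (volume.restrict Ω) ≤
      C * (eLpNorm (fun x => gradient (φ (ns k)) x - weakGradient Ω u x) 2 (volume.restrict Ω) +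
        eLpNorm (weakGradient Ω u) 2 (volume.restrict Ω)) := fun k => by
    refine (hC Ω _ (hφ (ns k))).trans (mul_le_mul_right ?_ _)
    have h1 := eLpNorm_add_le (μ := volume.restrict Ω) (p := 2)
      ((hφ (ns k)).continuous_gradient.aestronglyMeasurable.sub h.memLp_grad.aestronglyMeasurable)
      h.memLp_grad.aestronglyMeasurable one_le_two
    rwa [sub_add_cancel] at h1
  have htend : Tendsto (fun k => C *
      (eLpNorm (fun x => gradient (φ (ns k)) x - weakGradient Ω u x) 2 (volume.restrict Ω) +
        eLpNorm (weakGradient Ω u) 2 (volume.restrict Ω))) atTop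
      (𝓝 (C * (0 + eLpNorm (weakGradient Ω u) 2 (volume.restrict Ω)))) :=
    ENNReal.Tendsto.const_mul ((hφG.comp hns.tendsto_atTop).add tendsto_const_nhds)
      (Or.inr ENNReal.coe_ne_top)
  rw [zero_add] at htend
  exact (liminf_le_liminf (Eventually.of_forall hbound)).trans htend.liminf_eq.le

end Sobolev

/-! ### Estimates for the terms of the energy, and positivity of the best constant -/

section Energy

variable {n : ℕ} {μ : ℝ}

lemma one_lt_critExp (hn : 2 < n) (hμn : μ < n) : 1 < critExp n μ := by
  have hn' : (2 : ℝ) < n := by exact_mod_cast hn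
  rw [critExp, lt_div_iff₀ (by linarith)]
  linarith

/-- The double integral in `choquard` as a lower integral. -/
noncomputable def lchoquard (μ : ℝ) (Ω : Set (EuclideanSpace ℝ (Fin n)))
    (u : EuclideanSpace ℝ (Fin n) → ℝ) : ENNReal :=
  ∫⁻ x in Ω, ∫⁻ y in Ω, ‖u x‖ₑ ^ critExp n μ * ‖u y‖ₑ ^ critExp n μ * rieszKernel μ (x - y)

lemma aemeasurable_lintegral_choquard {Ω : Set (EuclideanSpace ℝ (Fin n))}
    {u : EuclideanSpace ℝ (Fin n) → ℝ} (hu : AEStronglyMeasurable u (volume.restrict Ω)) :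
    AEMeasurable (fun x => ∫⁻ y in Ω,
      ‖u x‖ₑ ^ critExp n μ * ‖u y‖ₑ ^ critExp n μ * rieszKernel μ (x - y))
      (volume.restrict Ω) := by
  have hm : AEMeasurable (fun x => ‖u x‖ₑ ^ critExp n μ) (volume.restrict Ω) :=
    hu.enorm.pow_const _
  have hprod : AEMeasurable (Function.uncurry fun x y : EuclideanSpace ℝ (Fin n) =>
      ‖u x‖ₑ ^ critExp n μ * ‖u y‖ₑ ^ critExp n μ * rieszKernel μ (x - y))
      ((volume.restrict Ω).prod (volume.restrict Ω)) :=
    (hm.comp_fst.mul hm.comp_snd).mul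
      ((measurable_rieszKernel μ).comp (measurable_fst.sub measurable_snd)).aemeasurable
  exact hprod.lintegral_prod_right'

/-- Bochner integrals default to 0 when they diverge; finiteness of the lower integral makes the
real double integral faithful. -/
lemma choquard_eq_toReal {Ω : Set (EuclideanSpace ℝ (Fin n))} {u : EuclideanSpace ℝ (Fin n) → ℝ}
    (hp : 0 ≤ critExp n μ) (hu : AEStronglyMeasurable u (volume.restrict Ω))
    (hfin : lchoquard μ Ω u ≠ ⊤) : choquard μ Ω u = (lchoquard μ Ω u).toReal := by
  have hout := aemeasurable_lintegral_choquard (μ := μ) hu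
  rw [lchoquard, ← integral_toReal hout (ae_lt_top' hout hfin), choquard]
  refine integral_congr_ae (ae_of_all _ fun x => ?_)
  dsimp only
  rw [integral_eq_lintegral_of_nonneg_ae (ae_of_all _ fun y => by positivity)]
  · congr 1
    refine lintegral_congr fun y => ?_
    rw [rieszKernel, Real.rpow_neg (norm_nonneg _), div_eq_mul_inv,
      ENNReal.ofReal_mul (by positivity), ENNReal.ofReal_mul (by positivity),
      ← ENNReal.ofReal_rpow_of_nonneg (abs_nonneg _) hp,
      ← ENNReal.ofReal_rpow_of_nonneg (abs_nonneg _) hp, ← Real.enorm_eq_ofReal_abs,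
      ← Real.enorm_eq_ofReal_abs]
  · refine AEMeasurable.aestronglyMeasurable ?_
    have := hu.aemeasurable
    fun_prop

/-- The kernel is positive off the diagonal. If the double integral vanished, one `x` with `u x ≠ 0`
and vanishing inner integral would force `u = 0` almost everywhere. -/
lemma lchoquard_ne_zero {Ω : Set (EuclideanSpace ℝ (Fin n))} {u : EuclideanSpace ℝ (Fin n) → ℝ}
    (hn : 0 < n) (hp : 0 < critExp n μ) (hu : AEStronglyMeasurable u (volume.restrict Ω))
    (h0 : ¬ u =ᵐ[volume.restrict Ω] 0) : lchoquard μ Ω u ≠ 0 := by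
  have : Nonempty (Fin n) := ⟨⟨0, hn⟩⟩
  intro h
  have hin : ∀ x, AEMeasurable (fun y => ‖u x‖ₑ ^ critExp n μ * ‖u y‖ₑ ^ critExp n μ *
      rieszKernel μ (x - y)) (volume.restrict Ω) := fun x => by
    have := hu.aemeasurable
    fun_prop
  rw [lchoquard, lintegral_eq_zero_iff' (aemeasurable_lintegral_choquard hu)] at h
  obtain ⟨x, hx0, hx⟩ : ∃ x, u x ≠ 0 ∧ ∫⁻ y in Ω, ‖u x‖ₑ ^ critExp n μ * ‖u y‖ₑ ^ critExp n μ *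
      rieszKernel μ (x - y) = 0 := by
    by_contra! hcon
    refine h0 ?_
    filter_upwards [h] with x hx
    by_contra hux
    exact hcon x hux hx
  rw [lintegral_eq_zero_iff' (hin x)] at hx
  -- The point `x` must be removed: for `μ ≠ 0` the convention for `0 ^ (-μ)` makes the kernel 0
  -- there.
  have hne : ∀ᵐ y ∂(volume.restrict Ω), y ≠ x :=
    ae_restrict_of_ae (compl_mem_ae_iff.2 (measure_singleton x))
  refine h0 ?_
  filter_upwards [hx, hne] with y hy hyx
  have hk : rieszKernel μ (x - y) ≠ 0 := by
    have : 0 < ‖x - y‖ := norm_pos_iff.2 (sub_ne_zero.2 hyx.symm)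
    rw [rieszKernel, ENNReal.ofReal_ne_zero_iff]
    positivity
  by_contra huy
  have hne0 : ∀ {z}, u z ≠ 0 → ‖u z‖ₑ ^ critExp n μ ≠ 0 := fun {z} hz => by
    simp [ENNReal.rpow_eq_zero_iff, hz, hp.not_gt]
  exact mul_ne_zero (mul_ne_zero (hne0 hx0) (hne0 huy)) hk hy

/-- The Hardy–Littlewood–Sobolev inequality at the critical exponent. -/
lemma exists_lchoquard_le (hn : 2 < n) (hμ0 : 0 < μ) (hμn : μ < n) :
    ∃ C : ℝ, 0 < C ∧ ∀ (Ω : Set (EuclideanSpace ℝ (Fin n))) (u : EuclideanSpace ℝ (Fin n) → ℝ),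
      AEStronglyMeasurable u (volume.restrict Ω) →
      lchoquard μ Ω u ≤ ENNReal.ofReal C *
        eLpNorm u (ENNReal.ofReal (2 * n / (n - 2))) (volume.restrict Ω) ^ (2 * critExp n μ) := by
  have hn' : (2 : ℝ) < n := by exact_mod_cast hn
  have : Nonempty (Fin n) := ⟨⟨0, by omega⟩⟩
  have h2 : (0 : ℝ) < n - 2 := by linarith
  have hden : (0 : ℝ) < 2 * n - μ := by linarith
  have hp := one_lt_critExp hn hμn
  obtain ⟨C, hC, h⟩ := exists_hardyLittlewoodSobolev
    (volume : Measure (EuclideanSpace ℝ (Fin n))) hμ0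
    (by rwa [finrank_euclideanSpace_fin]) (r := 2 * n / (2 * n - μ))
    (by rw [finrank_euclideanSpace_fin])
  refine ⟨C, hC, fun Ω u hu => ?_⟩
  refine (h (volume.restrict Ω) Measure.restrict_le_self _ (hu.enorm.pow_const _)).trans ?_
  have hs : (0 : ℝ) < 2 * n / (n - 2) := by positivity
  rw [eLpNorm_eq_lintegral_rpow_enorm_toReal (by simpa using hs) ENNReal.ofReal_ne_top,
    ENNReal.toReal_ofReal hs.le, ← ENNReal.rpow_mul]
  simp only [← ENNReal.rpow_mul]
  refine le_of_eq ?_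
  -- With `r = 2n / (2n - μ)`, the `L^r` norm of `|u| ^ critExp n μ` is a power of the critical
  -- Sobolev norm of `u`.
  have e1 : critExp n μ * (2 * n / (2 * n - μ)) = 2 * n / (n - 2) := by
    rw [critExp]; field_simp
  have e2 : 2 / (2 * n / (2 * n - μ)) = 1 / (2 * n / (n - 2)) * (2 * critExp n μ) := by
    rw [critExp]; field_simp
  rw [e1, e2]

/-- The Choquard term is finite and controlled by the Dirichlet integral. -/
theorem exists_choquard_le (hn : 2 < n) (hμ0 : 0 < μ) (hμn : μ < n) :
    ∃ K : ℝ, 0 < K ∧ ∀ (p : ENNReal) (Ω : Set (EuclideanSpace ℝ (Fin n)))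
      (u : EuclideanSpace ℝ (Fin n) → ℝ), p ≠ 0 → MemSobolevClosure p Ω u →
      lchoquard μ Ω u ≠ ⊤ ∧ choquard μ Ω u ≤ K * dirichlet Ω u ^ critExp n μ := by
  obtain ⟨C, hC, h⟩ := exists_lchoquard_le hn hμ0 hμn
  obtain ⟨S, hS⟩ := MemSobolevClosure.exists_eLpNorm_le hn
  have hp := one_lt_critExp hn hμn
  -- `S + 1` replaces `S` only to make the constant strictly positive.
  refine ⟨C * (S + 1 : ℝ) ^ (2 * critExp n μ), by positivity, fun p Ω u hp0 hu => ?_⟩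
  have hD := dirichlet_nonneg (Ω := Ω) (u := u)
  have key : lchoquard μ Ω u ≤ ENNReal.ofReal
      (C * (S + 1 : ℝ) ^ (2 * critExp n μ) * dirichlet Ω u ^ critExp n μ) := by
    refine (h Ω u hu.memLp.aestronglyMeasurable).trans ?_
    have h1 : eLpNorm u (ENNReal.ofReal (2 * n / (n - 2))) (volume.restrict Ω) ≤
        ENNReal.ofReal ((S + 1 : ℝ) * dirichlet Ω u ^ (1 / 2 : ℝ)) := by
      refine (hS p Ω u hp0 hu).trans ?_
      rw [hu.eLpNorm_weakGradient, ENNReal.ofReal_mul (by positivity)]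
      gcongr
      rw [← ENNReal.ofReal_coe_nnreal]
      exact ENNReal.ofReal_le_ofReal (by linarith)
    refine (mul_le_mul_right (ENNReal.rpow_le_rpow h1 (by positivity)) _).trans (le_of_eq ?_)
    rw [ENNReal.ofReal_rpow_of_nonneg (by positivity) (by positivity),
      ← ENNReal.ofReal_mul hC.le, Real.mul_rpow (by positivity) (by positivity),
      ← Real.rpow_mul hD, mul_assoc]
    congr 4
    ring
  have hfin : lchoquard μ Ω u ≠ ⊤ := ne_top_of_le_ne_top ENNReal.ofReal_ne_top key
  refine ⟨hfin, ?_⟩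
  rw [choquard_eq_toReal (by linarith) hu.memLp.aestronglyMeasurable hfin]
  exact ENNReal.toReal_le_of_le_ofReal (by positivity) key

theorem MemSobolevClosure.choquard_pos (hn : 2 < n) (hμ0 : 0 < μ) (hμn : μ < n) {p : ENNReal}
    (hp : p ≠ 0) {Ω : Set (EuclideanSpace ℝ (Fin n))} {u : EuclideanSpace ℝ (Fin n) → ℝ}
    (hu : MemSobolevClosure p Ω u) (h0 : ¬ u =ᵐ[volume.restrict Ω] 0) : 0 < choquard μ Ω u := by
  obtain ⟨K, -, hK⟩ := exists_choquard_le hn hμ0 hμn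
  have hp1 := one_lt_critExp hn hμn
  have hfin := (hK p Ω u hp hu).1
  rw [choquard_eq_toReal (by linarith) hu.memLp.aestronglyMeasurable hfin]
  exact ENNReal.toReal_pos
    (lchoquard_ne_zero (by omega) (by linarith) hu.memLp.aestronglyMeasurable h0) hfin

/-- A vanishing Dirichlet integral makes the critical norm vanish, by Sobolev. -/
theorem MemSobolevClosure.dirichlet_pos (hn : 2 < n) {p : ENNReal} (hp : p ≠ 0)
    {Ω : Set (EuclideanSpace ℝ (Fin n))} {u : EuclideanSpace ℝ (Fin n) → ℝ}
    (hu : MemSobolevClosure p Ω u) (h0 : ¬ u =ᵐ[volume.restrict Ω] 0) : 0 < dirichlet Ω u := by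
  have hn' : (2 : ℝ) < n := by exact_mod_cast hn
  have hs : (0 : ℝ) < 2 * n / (n - 2) := div_pos (by linarith) (by linarith)
  refine dirichlet_nonneg.lt_of_ne' fun hD => h0 ?_
  obtain ⟨S, hS⟩ := MemSobolevClosure.exists_eLpNorm_le hn
  have h := hS p Ω u hp hu
  rw [hu.eLpNorm_weakGradient, hD, Real.zero_rpow (by norm_num), ENNReal.ofReal_zero, mul_zero,
    nonpos_iff_eq_zero] at h
  exact (eLpNorm_eq_zero_iff hu.memLp.aestronglyMeasurable (by simpa using hs)).1 h

/-- On a set of finite measure, `∫ |u|^s` with `0 < s ≤ 2` is controlled by the Dirichlet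
integral. -/
theorem exists_setIntegral_rpow_le (hn : 2 < n) {Ω : Set (EuclideanSpace ℝ (Fin n))}
    (hΩ : volume Ω ≠ ⊤) {s : ℝ} (hs0 : 0 < s) (hs : s ≤ 2) :
    ∃ B : ℝ, 0 < B ∧ ∀ (p : ENNReal) (u : EuclideanSpace ℝ (Fin n) → ℝ), p ≠ 0 →
      MemSobolevClosure p Ω u → ∫ x in Ω, |u x| ^ s ≤ B * dirichlet Ω u ^ (s / 2) := by
  have hn' : (2 : ℝ) < n := by exact_mod_cast hn
  have h2 : (0 : ℝ) < n - 2 := by linarith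
  obtain ⟨S, hS⟩ := MemSobolevClosure.exists_eLpNorm_le hn
  -- The power of the volume in the inclusion of the critical Lebesgue space into `L^s`, valid also
  -- for `s < 1`.
  set e : ℝ := 1 / s - 1 / (2 * n / (n - 2)) with he
  have hss : s ≤ 2 * n / (n - 2) := hs.trans (by rw [le_div_iff₀ h2]; linarith)
  have he0 : 0 ≤ e := sub_nonneg.2 (one_div_le_one_div_of_le hs0 hss)
  set V : ℝ := ((volume Ω) ^ e).toReal with hV
  have hV0 : 0 ≤ V := ENNReal.toReal_nonneg
  have hVe : (volume Ω) ^ e = ENNReal.ofReal V :=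
    (ENNReal.ofReal_toReal (ENNReal.rpow_ne_top_of_nonneg he0 hΩ)).symm
  refine ⟨((S + 1 : ℝ) * (V + 1)) ^ s, by positivity, fun p u hp hu => ?_⟩
  have hD := dirichlet_nonneg (Ω := Ω) (u := u)
  have hm := hu.memLp.aestronglyMeasurable
  rw [integral_eq_lintegral_of_nonneg_ae (ae_of_all _ fun y => by positivity)
    (hm.aemeasurable.abs.pow_const s).aestronglyMeasurable]
  refine ENNReal.toReal_le_of_le_ofReal (by positivity) ?_
  have h1 : ∫⁻ x in Ω, ENNReal.ofReal (|u x| ^ s) =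
      eLpNorm u (ENNReal.ofReal s) (volume.restrict Ω) ^ s := by
    rw [eLpNorm_eq_lintegral_rpow_enorm_toReal (by simpa using hs0) ENNReal.ofReal_ne_top,
      ENNReal.toReal_ofReal hs0.le, ← ENNReal.rpow_mul, one_div_mul_cancel hs0.ne',
      ENNReal.rpow_one]
    refine lintegral_congr fun x => ?_
    rw [Real.enorm_eq_ofReal_abs, ENNReal.ofReal_rpow_of_nonneg (abs_nonneg _) hs0.le]
  have h3 : eLpNorm u (ENNReal.ofReal s) (volume.restrict Ω) ≤
      ENNReal.ofReal ((S + 1 : ℝ) * (V + 1) * dirichlet Ω u ^ (1 / 2 : ℝ)) := by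
    refine (eLpNorm_le_eLpNorm_mul_rpow_measure_univ (ENNReal.ofReal_le_ofReal hss) hm).trans ?_
    rw [ENNReal.toReal_ofReal hs0.le, ENNReal.toReal_ofReal (hs0.le.trans hss), ← he,
      Measure.restrict_apply_univ, hVe]
    refine (mul_le_mul_left (hS p Ω u hp hu) _).trans ?_
    rw [hu.eLpNorm_weakGradient, ← ENNReal.ofReal_coe_nnreal, ← ENNReal.ofReal_mul (by positivity),
      ← ENNReal.ofReal_mul (by positivity)]
    refine ENNReal.ofReal_le_ofReal ?_
    rw [mul_right_comm]
    gcongr <;> linarith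
  rw [h1]
  refine (ENNReal.rpow_le_rpow h3 hs0.le).trans (le_of_eq ?_)
  rw [ENNReal.ofReal_rpow_of_nonneg (by positivity) hs0.le,
    Real.mul_rpow (by positivity) (by positivity), ← Real.rpow_mul hD]
  congr 3
  ring

lemma MemHPlus.setIntegral_rpow_pos {q : ℝ} (hq : q < 1) {Ω : Set (EuclideanSpace ℝ (Fin n))}
    {u : EuclideanSpace ℝ (Fin n) → ℝ} (hu : MemHPlus q Ω u) :
    0 < ∫ x in Ω, |u x| ^ (1 - q) := by
  have hnn : ∀ x, 0 ≤ |u x| ^ (1 - q) := fun x => by positivity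
  refine (integral_nonneg hnn).lt_of_ne' fun h => hu.ne_zero ?_
  rw [integral_eq_zero_iff_of_nonneg hnn hu.integrable] at h
  filter_upwards [h] with x hx
  have : |u x| ^ (1 - q) = 0 := hx
  rwa [Real.rpow_eq_zero (abs_nonneg _) (by linarith), abs_eq_zero] at this

/-- There are nonnegative test functions that do not vanish almost everywhere. -/
lemma exists_isTestFunction {Ω : Set (EuclideanSpace ℝ (Fin n))} (hΩ : IsOpen Ω)
    (hne : Ω.Nonempty) : ∃ φ, IsTestFunction Ω φ ∧ (∀ x, 0 ≤ φ x) ∧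
      ¬ φ =ᵐ[volume.restrict Ω] 0 := by
  obtain ⟨x, hx⟩ := hne
  obtain ⟨φ, hsupp, hcpt, hsm, hrange, hφx⟩ :=
    exists_contDiff_tsupport_subset (n := ⊤) (hΩ.mem_nhds hx)
  refine ⟨φ, ⟨hsm, hcpt, hsupp⟩, fun y => (hrange ⟨y, rfl⟩).1, fun h => ?_⟩
  have := Measure.eqOn_open_of_ae_eq (μ := volume) h hΩ hsm.continuous.continuousOn
    continuousOn_const hx
  simp [hφx] at this

lemma IsTestFunction.memHPlus {q : ℝ} (hq : q < 1) {Ω : Set (EuclideanSpace ℝ (Fin n))}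
    (hΩ : IsOpen Ω) {φ : EuclideanSpace ℝ (Fin n) → ℝ} (hφ : IsTestFunction Ω φ)
    (hnn : ∀ x, 0 ≤ φ x) (h0 : ¬ φ =ᵐ[volume.restrict Ω] 0) : MemHPlus q Ω φ where
  memH10 := hφ.memSobolevClosure hΩ 2
  nonneg := ae_of_all _ hnn
  ne_zero := h0
  integrable := by
    refine ((hφ.continuous.abs.rpow_const fun x => Or.inr (by linarith)).integrable_of_hasCompactSupport
      (hφ.hasCompactSupport.mono fun x hx h => hx ?_)).integrableOn
    simp only [h, abs_zero]
    exact Real.zero_rpow (by linarith)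

/-- The best constant is positive. -/
theorem SHL_pos (hn : 2 < n) (hμ0 : 0 < μ) (hμn : μ < n) : 0 < SHL n μ := by
  obtain ⟨K, hK0, hK⟩ := exists_choquard_le hn hμ0 hμn
  have hn' : (2 : ℝ) < n := by exact_mod_cast hn
  have hp := one_lt_critExp hn hμn
  have hs : ENNReal.ofReal (2 * n / (n - 2)) ≠ 0 := by
    simpa using div_pos (by linarith) (by linarith : (0 : ℝ) < n - 2)
  -- Taking the root of `c ≤ K a ^ p` bounds every quotient below. Nonemptiness matters because
  -- `sInf ∅ = 0`.
  refine lt_of_lt_of_le (by positivity : 0 < (K ^ (1 / critExp n μ))⁻¹) (le_csInf ?_ ?_)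
  · obtain ⟨φ, hφ, -, h0⟩ := exists_isTestFunction (n := n) isOpen_univ Set.univ_nonempty
    rw [Measure.restrict_univ] at h0
    exact ⟨_, φ, hφ.memSobolevClosure isOpen_univ _, h0, rfl⟩
  · rintro r ⟨u, hu, h0, rfl⟩
    rw [← Measure.restrict_univ (μ := volume)] at h0
    have hD := hu.dirichlet_pos hn hs h0
    have hc := hu.choquard_pos hn hμ0 hμn hs h0
    rw [le_div_iff₀ (by positivity), inv_mul_le_iff₀ (by positivity)]
    refine (Real.rpow_le_rpow hc.le (hK _ _ u hs hu).2 (by positivity)).trans (le_of_eq ?_)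
    rw [Real.mul_rpow hK0.le (by positivity), ← Real.rpow_mul hD.le,
      mul_one_div_cancel (by positivity), Real.rpow_one]

end Energy

/-! ### Differences of two powers, and derivatives of the model fiber map -/

section RealVariable

/-- `a t^α - c t^β` takes a given value at no three positive points. -/
lemma not_three_eq_of_lt {a c α β k x y z : ℝ} (hc : 0 < c) (hα : 0 < α) (hαβ : α < β)
    (hx : 0 < x) (hxy : x < y) (hyz : y < z) (h1 : a * x ^ α - c * x ^ β = k)
    (h2 : a * y ^ α - c * y ^ β = k) (h3 : a * z ^ α - c * z ^ β = k) : False := by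
  have hy : 0 < y := hx.trans hxy
  have hz : 0 < z := hy.trans hyz
  have hXY : x ^ α < y ^ α := Real.rpow_lt_rpow hx.le hxy hα
  have hYZ : y ^ α < z ^ α := Real.rpow_lt_rpow hy.le hyz hα
  have hpow : ∀ {t : ℝ}, 0 < t → (t ^ α) ^ (β / α) = t ^ β := fun {t} ht => by
    rw [← Real.rpow_mul ht.le, mul_div_cancel₀ _ hα.ne']
  have hne : z ^ α - x ^ α ≠ 0 := by linarith
  -- In the variable `X = t ^ α` the function is `a X - c X ^ (β / α)`, strictly concave. The
  -- weights `w`, `v` express `y ^ α` as a convex combination of `x ^ α` and `z ^ α`.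
  set w := (z ^ α - y ^ α) / (z ^ α - x ^ α) with hw
  set v := (y ^ α - x ^ α) / (z ^ α - x ^ α) with hv
  have hsum : w + v = 1 := by rw [hw, hv]; field_simp; ring
  have hconv := (strictConvexOn_rpow ((one_lt_div hα).2 hαβ)).2
    (Set.mem_Ici.2 (Real.rpow_nonneg hx.le α)) (Set.mem_Ici.2 (Real.rpow_nonneg hz.le α))
    (hXY.trans hYZ).ne (div_pos (by linarith) (by linarith) : 0 < w)
    (div_pos (by linarith) (by linarith) : 0 < v) hsum
  simp only [smul_eq_mul] at hconv
  have hcomb : w * x ^ α + v * z ^ α = y ^ α := by rw [hw, hv]; field_simp; ring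
  rw [hcomb, hpow hx, hpow hy, hpow hz] at hconv
  have := mul_lt_mul_of_pos_left hconv hc
  have e : a * y ^ α - c * (w * x ^ β + v * z ^ β) = k := by
    rw [← hcomb]
    linear_combination w * h1 + v * h3 + k * hsum
  linarith

/-- The function vanishes at 0 and at `T` and exceeds `k` in between, which gives two solutions;
`not_three_eq_of_lt` excludes a third. -/
lemma encard_setOf_eq_two {a c α β k : ℝ} (ha : 0 < a) (hc : 0 < c) (hα : 0 < α) (hαβ : α < β)
    (hk0 : 0 < k) (hk : k < a / 2 * (a / (2 * c)) ^ (α / (β - α))) :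
    {t : ℝ | 0 < t ∧ a * t ^ α - c * t ^ β = k}.encard = 2 := by
  have hd : 0 < β - α := sub_pos.2 hαβ
  set G : ℝ → ℝ := fun t => a * t ^ α - c * t ^ β with hG
  have hcont : Continuous G := by
    refine (continuous_const.mul (continuous_id.rpow_const fun _ => Or.inr hα.le)).sub
      (continuous_const.mul (continuous_id.rpow_const fun _ => Or.inr (hα.trans hαβ).le))
  have hfac : ∀ {t : ℝ}, 0 < t → G t = t ^ α * (a - c * t ^ (β - α)) := fun {t} ht => by
    have : t ^ β = t ^ α * t ^ (β - α) := by rw [← Real.rpow_add ht]; congr 1; ring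
    simp only [hG, this]
    ring
  -- Here `c t₀ ^ (β - α) = a / 2`. This need not be the maximizer; a simple lower bound for the
  -- maximum is enough.
  set t₀ : ℝ := (a / (2 * c)) ^ (1 / (β - α)) with ht₀
  set T : ℝ := (a / c) ^ (1 / (β - α)) with hT
  have ht₀0 : 0 < t₀ := by positivity
  have hT0 : 0 < T := by positivity
  have htT : t₀ ≤ T := by
    refine Real.rpow_le_rpow (by positivity) ?_ (by positivity)
    exact div_le_div_of_nonneg_left ha.le hc (by linarith)
  have hG0 : G 0 = 0 := by
    simp [hG, Real.zero_rpow hα.ne', Real.zero_rpow (hα.trans hαβ).ne']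
  have hGt : k < G t₀ := by
    refine hk.trans_le (le_of_eq ?_)
    rw [hfac ht₀0, ht₀, ← Real.rpow_mul (by positivity), ← Real.rpow_mul (by positivity),
      one_div_mul_cancel hd.ne', Real.rpow_one, one_div_mul_eq_div]
    field_simp
    ring
  have hGT : G T = 0 := by
    rw [hfac hT0, hT, ← Real.rpow_mul (by positivity) _ (β - α), one_div_mul_cancel hd.ne',
      Real.rpow_one, mul_div_cancel₀ _ hc.ne', sub_self, mul_zero]
  obtain ⟨t₁, ht₁, hGt₁⟩ := intermediate_value_Ioo ht₀0.le hcont.continuousOn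
    (show k ∈ Set.Ioo (G 0) (G t₀) from ⟨by rwa [hG0], hGt⟩)
  obtain ⟨t₂, ht₂, hGt₂⟩ := intermediate_value_Ioo' htT hcont.continuousOn
    (show k ∈ Set.Ioo (G T) (G t₀) from ⟨by rwa [hGT], hGt⟩)
  have h12 : t₁ < t₂ := ht₁.2.trans ht₂.1
  have hset : {t : ℝ | 0 < t ∧ a * t ^ α - c * t ^ β = k} = {t₁, t₂} := by
    ext t
    simp only [Set.mem_ofPred_eq, Set.mem_insert_iff, Set.mem_singleton_iff]
    constructor
    · rintro ⟨ht, hGt⟩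
      by_contra! hne
      rcases lt_or_gt_of_ne hne.1 with h | h
      · exact not_three_eq_of_lt hc hα hαβ ht h h12 hGt hGt₁ hGt₂
      rcases lt_or_gt_of_ne hne.2 with h' | h'
      · exact not_three_eq_of_lt hc hα hαβ ht₁.1 h h' hGt₁ hGt hGt₂
      · exact not_three_eq_of_lt hc hα hαβ ht₁.1 h12 h' hGt₁ hGt₂ hGt
    · rintro (rfl | rfl)
      · exact ⟨ht₁.1, hGt₁⟩
      · exact ⟨ht₁.1.trans h12, hGt₂⟩
  rw [hset, Set.encard_pair h12.ne]

/-- Either `c t ^ (β - α) ≤ a`, which bounds `t ^ α`, or the left side is nonpositive. -/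
lemma le_of_mul_rpow_sub_mul_rpow_eq {a c α β k t : ℝ} (ha : 0 < a) (hc : 0 < c) (hα : 0 < α)
    (hαβ : α < β) (ht : 0 < t) (h : a * t ^ α - c * t ^ β = k) :
    k ≤ a * (a / c) ^ (α / (β - α)) := by
  have hd : 0 < β - α := sub_pos.2 hαβ
  have hβ : t ^ β = t ^ α * t ^ (β - α) := by rw [← Real.rpow_add ht]; congr 1; ring
  have htα : 0 < t ^ α := by positivity
  rcases le_total (t ^ (β - α)) (a / c) with hle | hle
  · have h1 : t ^ α ≤ (a / c) ^ (α / (β - α)) := by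
      have := Real.rpow_le_rpow (by positivity) hle (by positivity : 0 ≤ α / (β - α))
      rwa [← Real.rpow_mul ht.le, mul_div_cancel₀ _ hd.ne'] at this
    have h2 : 0 < c * t ^ β := by positivity
    have := mul_le_mul_of_nonneg_left h1 ha.le
    linarith
  · have h1 : a ≤ c * t ^ (β - α) := by rwa [div_le_iff₀' hc] at hle
    have h2 : 0 ≤ a * (a / c) ^ (α / (β - α)) := by positivity
    have h3 := mul_le_mul_of_nonneg_left h1 htα.le
    rw [hβ] at h
    linarith

lemma hasDerivAt_fiberModel (a b c lam : ℝ) {p q t : ℝ} (hp : 0 < p) (hq : q < 1) (ht : 0 < t) :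
    HasDerivAt (fun t => 1 / 2 * (t ^ 2 * a) - lam / (1 - q) * (t ^ (1 - q) * b)
      - 1 / (2 * p) * (t ^ (2 * p) * c))
      (t * a - lam * (t ^ (-q) * b) - t ^ (2 * p - 1) * c) t := by
  have h1 := ((hasDerivAt_pow 2 t).mul_const a).const_mul (1 / 2)
  have h2 := ((Real.hasDerivAt_rpow_const (p := 1 - q) (Or.inl ht.ne')).mul_const b).const_mul
    (lam / (1 - q))
  have h3 := ((Real.hasDerivAt_rpow_const (p := 2 * p) (Or.inl ht.ne')).mul_const c).const_mul
    (1 / (2 * p))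
  refine ((h1.sub h2).sub h3).congr_deriv ?_
  have hq' : 1 - q ≠ 0 := by linarith
  rw [show 1 - q - 1 = -q by ring]
  field_simp
  push_cast
  ring

lemma hasDerivAt_deriv_fiberModel (a b c lam p q : ℝ) :
    HasDerivAt (fun t => t * a - lam * (t ^ (-q) * b) - t ^ (2 * p - 1) * c)
      (a + q * lam * b - (2 * p - 1) * c) 1 := by
  have h1 := (hasDerivAt_id (1 : ℝ)).mul_const a
  have h2 := ((Real.hasDerivAt_rpow_const (x := 1) (p := -q) (Or.inl one_ne_zero)).mul_const
    b).const_mul lam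
  have h3 := (Real.hasDerivAt_rpow_const (x := 1) (p := 2 * p - 1) (Or.inl one_ne_zero)).mul_const c
  refine ((h1.sub h2).sub h3).congr_deriv ?_
  simp only [Real.one_rpow]
  ring

/-- Multiplication by `t ^ q` clears the singular power and isolates the constant `lam * b`. -/
lemma fiberModel_deriv_eq_zero_iff (a b c lam : ℝ) {p q t : ℝ} (ht : 0 < t) :
    t * a - lam * (t ^ (-q) * b) - t ^ (2 * p - 1) * c = 0 ↔
      a * t ^ (1 + q) - c * t ^ (2 * p - 1 + q) = lam * b := by
  have htq : 0 < t ^ q := by positivity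
  rw [Real.rpow_add ht, Real.rpow_add ht, Real.rpow_one, Real.rpow_neg ht.le]
  constructor
  · intro h
    have : t ^ q * (t * a - lam * ((t ^ q)⁻¹ * b) - t ^ (2 * p - 1) * c) = 0 := by
      rw [h, mul_zero]
    field_simp at this
    linarith
  · intro h
    field_simp
    linarith

end RealVariable

/-! ### Critical points of the fiber map -/

section Fiber

variable {n : ℕ} {μ q lam : ℝ} {Ω : Set (EuclideanSpace ℝ (Fin n))}
  {u : EuclideanSpace ℝ (Fin n) → ℝ} {s : ENNReal}

lemma MemSobolevClosure.hasDerivAt_fiber (hΩ : IsOpen Ω) (hu : MemSobolevClosure s Ω u)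
    (hp : 0 < critExp n μ) (hq : q < 1) {t : ℝ} (ht : 0 < t) :
    HasDerivAt (fiber μ q lam Ω u) (t * dirichlet Ω u
      - lam * (t ^ (-q) * ∫ x in Ω, |u x| ^ (1 - q))
      - t ^ (2 * critExp n μ - 1) * choquard μ Ω u) t := by
  refine (hasDerivAt_fiberModel _ _ _ lam hp hq ht).congr_of_eventuallyEq ?_
  filter_upwards [lt_mem_nhds ht] with τ hτ using hu.fiber_eq hΩ μ q lam hτ.le

lemma MemSobolevClosure.critPoints_eq (hΩ : IsOpen Ω) (hu : MemSobolevClosure s Ω u)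
    (hp : 0 < critExp n μ) (hq : q < 1) :
    critPoints μ q lam Ω u = {t | 0 < t ∧ dirichlet Ω u * t ^ (1 + q)
      - choquard μ Ω u * t ^ (2 * critExp n μ - 1 + q) = lam * ∫ x in Ω, |u x| ^ (1 - q)} := by
  ext t
  refine and_congr_right fun ht => ?_
  have h := hu.hasDerivAt_fiber (lam := lam) hΩ hp hq ht
  rw [← fiberModel_deriv_eq_zero_iff _ _ _ _ ht]
  exact ⟨fun h' => h.unique h', fun h' => h'  ▸ h⟩

/-- On `N_λ^+` the Dirichlet integral is controlled by the singular term. -/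
lemma dirichlet_lt_of_mem_nehariPlus (hΩ : IsOpen Ω) (hp : 0 < critExp n μ) (hq : q < 1)
    (hu : u ∈ nehariPlus μ q lam Ω) :
    (2 * critExp n μ - 2) * dirichlet Ω u <
      (2 * critExp n μ - 1 + q) * (lam * ∫ x in Ω, |u x| ^ (1 - q)) := by
  obtain ⟨huP, h1, h2⟩ := hu
  have hderiv : deriv (fiber μ q lam Ω u) =ᶠ[𝓝 1] fun t => t * dirichlet Ω u
      - lam * (t ^ (-q) * ∫ x in Ω, |u x| ^ (1 - q))
      - t ^ (2 * critExp n μ - 1) * choquard μ Ω u := by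
    filter_upwards [lt_mem_nhds one_pos] with τ hτ using
      (huP.memH10.hasDerivAt_fiber hΩ hp hq hτ).deriv
  rw [hderiv.deriv_eq, (hasDerivAt_deriv_fiberModel _ _ _ _ _ _).deriv] at h2
  have h3 := h1.unique (huP.memH10.hasDerivAt_fiber hΩ hp hq one_pos)
  simp only [Real.one_rpow, one_mul] at h3
  -- The first-order condition eliminates the Choquard term from the second-order one.
  have h4 : choquard μ Ω u = dirichlet Ω u - lam * ∫ x in Ω, |u x| ^ (1 - q) := by linarith
  rw [h4] at h2
  linarith

end Fiber

/-! ### Admissible parameters -/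

section Main

variable {n : ℕ} {μ q : ℝ} {Ω : Set (EuclideanSpace ℝ (Fin n))}

/-- Every `u ∈ H_{+,q}` has exactly two critical points on its fiber when `λ` is small. -/
theorem exists_pos_encard_critPoints_eq_two (hn : 2 < n) (hμ0 : 0 < μ) (hμn : μ < n) (hq0 : 0 < q)
    (hq1 : q < 1) (hΩ : IsOpen Ω) (hΩb : Bornology.IsBounded Ω) :
    ∃ δ : ℝ, 0 < δ ∧ ∀ lam : ℝ, 0 < lam → lam < δ → ∀ u, MemHPlus q Ω u →
      (critPoints μ q lam Ω u).encard = 2 := by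
  have hp := one_lt_critExp hn hμn
  set p := critExp n μ with hpdef
  obtain ⟨K, hK0, hK⟩ := exists_choquard_le hn hμ0 hμn
  obtain ⟨B, hB0, hB⟩ := exists_setIntegral_rpow_le hn hΩb.measure_lt_top.ne
    (by linarith : 0 < 1 - q) (by linarith)
  set θ : ℝ := (1 + q) / (2 * p - 2) with hθ
  have hθ0 : 0 < θ := div_pos (by linarith) (by linarith)
  -- The criterion of `encard_setOf_eq_two` with `c` and `b` replaced by their bounds, the powers of
  -- `a` cancelled.
  refine ⟨1 / 2 * (1 / (2 * K)) ^ θ / B, by positivity, fun lam hlam0 hlam u hu => ?_⟩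
  have hu2 : MemSobolevClosure 2 Ω u := hu.memH10
  have ha := hu2.dirichlet_pos hn two_ne_zero hu.ne_zero
  have hc := hu2.choquard_pos hn hμ0 hμn two_ne_zero hu.ne_zero
  have hb := hu.setIntegral_rpow_pos hq1
  have hcK := (hK 2 Ω u two_ne_zero hu2).2
  have hbB := hB 2 u two_ne_zero hu2
  rw [hu2.critPoints_eq hΩ (by linarith) hq1]
  set a := dirichlet Ω u
  set b := ∫ x in Ω, |u x| ^ (1 - q)
  set c := choquard μ Ω u
  refine encard_setOf_eq_two ha hc (by linarith) (by linarith) (by positivity) ?_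
  rw [show 2 * p - 1 + q - (1 + q) = 2 * p - 2 by ring, ← hθ]
  have hquot : 1 / (2 * K) * a ^ (1 - p) ≤ a / (2 * c) := by
    have : 1 / (2 * K) * a ^ (1 - p) = a / (2 * (K * a ^ p)) := by
      rw [Real.rpow_sub ha, Real.rpow_one]
      field_simp
    rw [this]
    exact div_le_div_of_nonneg_left ha.le (by positivity) (by linarith)
  have hexp : a * (a ^ (1 - p)) ^ θ = a ^ ((1 - q) / 2) := by
    rw [← Real.rpow_mul ha.le]
    nth_rewrite 1 [← Real.rpow_one a]
    rw [← Real.rpow_add ha]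
    congr 1
    have hθp : θ * (2 * p - 2) = 1 + q := div_mul_cancel₀ _ (by linarith)
    linear_combination (-1 / 2) * hθp
  rw [lt_div_iff₀ hB0] at hlam
  calc lam * b ≤ lam * (B * a ^ ((1 - q) / 2)) := mul_le_mul_of_nonneg_left hbB hlam0.le
    _ = lam * B * a ^ ((1 - q) / 2) := by ring
    _ < 1 / 2 * (1 / (2 * K)) ^ θ * a ^ ((1 - q) / 2) :=
        mul_lt_mul_of_pos_right hlam (by positivity)
    _ = a / 2 * (1 / (2 * K) * a ^ (1 - p)) ^ θ := by
        rw [Real.mul_rpow (by positivity) (by positivity), ← hexp]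
        ring
    _ ≤ a / 2 * (a / (2 * c)) ^ θ := by gcongr

/-- The Dirichlet integral is arbitrarily small on `N_λ^+` when `λ` is small. -/
theorem exists_pos_dirichlet_le_of_mem_nehariPlus (hn : 2 < n) (hμn : μ < n)
    (hq0 : 0 < q) (hq1 : q < 1) (hΩ : IsOpen Ω) (hΩb : Bornology.IsBounded Ω) {R : ℝ}
    (hR : 0 < R) :
    ∃ δ : ℝ, 0 < δ ∧ ∀ lam : ℝ, 0 < lam → lam < δ → ∀ u ∈ nehariPlus μ q lam Ω,
      dirichlet Ω u ≤ R := by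
  have hp := one_lt_critExp hn hμn
  set p := critExp n μ with hpdef
  obtain ⟨B, hB0, hB⟩ := exists_setIntegral_rpow_le hn hΩb.measure_lt_top.ne
    (by linarith : 0 < 1 - q) (by linarith)
  have h1 : 0 < 2 * p - 2 := by linarith
  have h2 : 0 < 2 * p - 1 + q := by linarith
  -- The `λ` for which `(2p - 2) a = (2p - 1 + q) λ B a ^ ((1 - q) / 2)` holds at `a = R`; beyond
  -- `R` the left side dominates since `(1 - q) / 2 < 1`.
  refine ⟨(2 * p - 2) * R ^ ((1 + q) / 2) / ((2 * p - 1 + q) * B), by positivity,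
    fun lam hlam0 hlam u hu => ?_⟩
  have hlt := dirichlet_lt_of_mem_nehariPlus hΩ (by linarith) hq1 hu
  rw [← hpdef] at hlt
  have hu2 : MemSobolevClosure 2 Ω u := hu.1.memH10
  have hbB := hB 2 u two_ne_zero hu2
  have ha := hu2.dirichlet_pos hn two_ne_zero hu.1.ne_zero
  set a := dirichlet Ω u
  by_contra! hRa
  rw [lt_div_iff₀ (by positivity)] at hlam
  have hsplit : a = a ^ ((1 + q) / 2) * a ^ ((1 - q) / 2) := by
    rw [← Real.rpow_add ha, show (1 + q) / 2 + (1 - q) / 2 = 1 by ring, Real.rpow_one]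
  have hpow : R ^ ((1 + q) / 2) ≤ a ^ ((1 + q) / 2) := by gcongr
  have h3 : (2 * p - 1 + q) * (lam * ∫ x in Ω, |u x| ^ (1 - q)) ≤
      lam * ((2 * p - 1 + q) * B) * a ^ ((1 - q) / 2) :=
    calc _ ≤ (2 * p - 1 + q) * (lam * (B * a ^ ((1 - q) / 2))) := by gcongr
      _ = _ := by ring
  have h4 : lam * ((2 * p - 1 + q) * B) * a ^ ((1 - q) / 2) ≤ (2 * p - 2) * a :=
    calc _ ≤ (2 * p - 2) * R ^ ((1 + q) / 2) * a ^ ((1 - q) / 2) := by gcongr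
      _ ≤ (2 * p - 2) * a ^ ((1 + q) / 2) * a ^ ((1 - q) / 2) := by gcongr
      _ = (2 * p - 2) * a := by rw [mul_assoc, ← hsplit]
  linarith

theorem exists_pos_mem_admissible (hn : 2 < n) (hμ0 : 0 < μ) (hμn : μ < n) (hq0 : 0 < q)
    (hq1 : q < 1) (hΩ : IsOpen Ω) (hΩb : Bornology.IsBounded Ω) :
    ∃ lam : ℝ, 0 < lam ∧ lam ∈ admissible μ q Ω := by
  have hp := one_lt_critExp hn hμn
  have hS := SHL_pos hn hμ0 hμn
  obtain ⟨δ₁, hδ₁, h1⟩ := exists_pos_encard_critPoints_eq_two hn hμ0 hμn hq0 hq1 hΩ hΩb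
  obtain ⟨δ₂, hδ₂, h2⟩ := exists_pos_dirichlet_le_of_mem_nehariPlus hn hμn hq0 hq1 hΩ hΩb
    (R := (critExp n μ * SHL n μ ^ critExp n μ) ^ (1 / (critExp n μ - 1))) (by positivity)
  obtain ⟨lam, hlam0, hlam⟩ := exists_between (lt_min hδ₁ hδ₂)
  exact ⟨lam, hlam0, hlam0, h1 lam hlam0 (hlam.trans_le (min_le_left _ _)),
    iSup₂_le fun u hu => EReal.coe_le_coe_iff.2
      (h2 lam hlam0 (hlam.trans_le (min_le_right _ _)) u hu)⟩

/-- One nonnegative nonzero test function suffices, and only the existence of a critical point on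
its fiber is needed. -/
theorem bddAbove_admissible (hn : 2 < n) (hμ0 : 0 < μ) (hμn : μ < n) (hq0 : 0 < q)
    (hq1 : q < 1) (hΩ : IsOpen Ω) (hne : Ω.Nonempty) : BddAbove (admissible μ q Ω) := by
  have hp := one_lt_critExp hn hμn
  obtain ⟨φ, hφ, hφ0, hφne⟩ := exists_isTestFunction hΩ hne
  have hu : MemHPlus q Ω φ := hφ.memHPlus hq1 hΩ hφ0 hφne
  have hu2 : MemSobolevClosure 2 Ω φ := hu.memH10
  have ha := hu2.dirichlet_pos hn two_ne_zero hu.ne_zero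
  have hc := hu2.choquard_pos hn hμ0 hμn two_ne_zero hu.ne_zero
  have hb := hu.setIntegral_rpow_pos hq1
  refine ⟨dirichlet Ω φ * (dirichlet Ω φ / choquard μ Ω φ) ^
    ((1 + q) / (2 * critExp n μ - 1 + q - (1 + q))) / ∫ x in Ω, |φ x| ^ (1 - q), ?_⟩
  rintro lam ⟨-, h, -⟩
  obtain ⟨t, ht⟩ : (critPoints μ q lam Ω φ).Nonempty := by
    rw [← Set.encard_ne_zero, h φ hu]
    exact two_ne_zero
  rw [hu2.critPoints_eq hΩ (by linarith) hq1] at ht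
  rw [le_div_iff₀ hb]
  exact le_of_mul_rpow_sub_mul_rpow_eq ha hc (by linarith) (by linarith) ht.1 ht.2

end Main

end Choquard

theorem theorem2p2 (n : ℕ) (hn : 2 < n) (μ : ℝ) (hμ0 : 0 < μ) (hμn : μ < n)
    (q : ℝ) (hq0 : 0 < q) (hq1 : q < 1)
    (Ω : Set (EuclideanSpace ℝ (Fin n))) (hΩ_open : IsOpen Ω) (hΩ_conn : IsConnected Ω)
    (hΩ_bdd : Bornology.IsBounded Ω) :
    IsLUB (Choquard.admissible μ q Ω) (Choquard.Lam μ q Ω) ∧ 0 < Choquard.Lam μ q Ω := by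
  obtain ⟨lam, hlam0, hlam⟩ :=
    Choquard.exists_pos_mem_admissible hn hμ0 hμn hq0 hq1 hΩ_open hΩ_bdd
  have hbdd := Choquard.bddAbove_admissible hn hμ0 hμn hq0 hq1 hΩ_open hΩ_conn.nonempty
  exact ⟨isLUB_csSup ⟨lam, hlam⟩ hbdd, hlam0.trans_le (le_csSup hbdd hlam)⟩
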